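/- Let $0 < c_- $ and let $\mu$ be a probability measure on the interval $[c_-,c^+]$ with mean $1$ and variance $\sigma^2 > 0$. Let $\mathbb{X}$ be the set of configurations $\mathbf{x} = (x_0,x_1,x_2,\ldots)$ with $0 = x_0 < x_1 < x_2 < \cdots$ and $x_i - x_{i-1} \in [c_-,c^+]$ for all $i \ge 1$. The spatial queue process is the $\mathbb{X}$-valued Markov chain $(\mathbf{X}(t),\ t = 0,1,2,\ldots)$ constructed as follows. Take i.i.d. random variables $(\xi_i(t),\ i \ge 1, t \ge 1)$ with distribution $\mu$, independent of the (arbitrary, possibly random) initial configuration $\mathbf{X}(0) \in \mathbb{X}$, and for $t \ge 1$ define \[ W(t) = \min\{ i \ge 1 : \ \xi_1(t) + \cdots + \xi_{i-1}(t) \ge X_{i+1}(t-1) - c^+ \} \in \{1,2,\ldots\} \cup \{\infty\} \] (with $\min \emptyset = \infty$, and the empty sum equal to $0$), and \[ X_i(t) = \xi_1(t) + \cdots + \xi_i(t) \ \text{ for } 0 \le i < W(t), \qquad X_i(t) = X_{i+1}(t-1) \ \text{ for } i \ge W(t). \] So $W(t)$, the wave length at step $t$, is the number of customers who move at step $t$.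 For $j \ge 1$ define \[ \rho^+(j) = \limsup_{\tau\to\infty} \tau^{-1} \sum_{t=1}^{\tau} \Pr(W(t) > j), \qquad \rho_-(j) = \liminf_{\tau\to\infty} \tau^{-1} \sum_{t=1}^{\tau} \Pr(W(t) > j). \] Then there exist constants $0 < a_- < a^+ < \infty$, depending only on $\mu$ and $c_-, c^+$ (and not on the initial configuration or on $j$), such that \[ a_- \, j^{-1/2} \le \rho_-(j) \le \rho^+(j) \le a^+ \, j^{-1/2} \qquad \text{for all } j \ge 1. \] -/

import Mathlib

open MeasureTheory ProbabilityTheory Filter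

noncomputable section

/-- The state space: configurations `0 = x 0 < x 1 < x 2 < ⋯` with all spacings in `[cm, cp]`;
`x i` is the position of the customer of rank `i`. -/
def queueConfigs (cm cp : ℝ) : Set (ℕ → ℝ) :=
  {x | x 0 = 0 ∧ StrictMono x ∧ ∀ i, x (i + 1) - x i ∈ Set.Icc cm cp}

/-- The wave length (number of customers who move) of one step from the configuration `x`, when the
chosen stopping distances are `d 0, d 1, …`, so that the customer of new rank `i`, if they move,
stops at `d 0 + ⋯ + d (i - 1)`.  The customer of old rank `m + 2` is the first one who does not
move when `m` is least such that the new position `d 0 + ⋯ + d (m - 1)` of the customer in front is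
at least `x (m + 2) - cp`; then the customers of old ranks `1, …, m + 1` have moved.
The value is `⊤` if everybody moves. -/
def waveLength (cp : ℝ) (x d : ℕ → ℝ) : ℕ∞ :=
  ⨅ (m : ℕ) (_ : x (m + 2) - cp ≤ ∑ k ∈ Finset.range m, d k), ((m + 1 : ℕ) : ℕ∞)

/-- The configuration after one step from `x` with stopping distances `d`. -/
def queueStep (cp : ℝ) (x d : ℕ → ℝ) : ℕ → ℝ := fun i =>
  if (i : ℕ∞) < waveLength cp x d then ∑ k ∈ Finset.range i, d k else x (i + 1)

/-- The trajectory of the spatial queue started from `x`; step number `t + 1` uses the stopping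
distances `ξ t 0, ξ t 1, …`. -/
def spatialQueue (cp : ℝ) (x : ℕ → ℝ) (ξ : ℕ → ℕ → ℝ) : ℕ → ℕ → ℝ
  | 0 => x
  | t + 1 => queueStep cp (spatialQueue cp x ξ t) (ξ t)

/-- The length of the wave at step number `t + 1`. -/
def queueWave (cp : ℝ) (x : ℕ → ℝ) (ξ : ℕ → ℕ → ℝ) (t : ℕ) : ℕ∞ :=
  waveLength cp (spatialQueue cp x ξ t) (ξ t)

/-- The average over the first `τ` steps of the probabilities that the wave length exceeds `j`,
for the random initial configuration `X₀` and the random stopping distances `ξ`. -/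
def avgWaveProb {Ω : Type*} [MeasurableSpace Ω] (P : Measure Ω) (cp : ℝ)
    (X₀ : Ω → ℕ → ℝ) (ξ : ℕ → ℕ → Ω → ℝ) (j τ : ℕ) : ℝ :=
  (τ : ℝ)⁻¹ * ∑ t ∈ Finset.range τ,
    P.real {ω | (j : ℕ∞) < queueWave cp (X₀ ω) (fun s i => ξ s i ω) t}

/-- The upper asymptotic rate of waves longer than `j`. -/
def upperWaveRate {Ω : Type*} [MeasurableSpace Ω] (P : Measure Ω) (cp : ℝ)
    (X₀ : Ω → ℕ → ℝ) (ξ : ℕ → ℕ → Ω → ℝ) (j : ℕ) : ℝ :=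
  limsup (fun τ : ℕ => avgWaveProb P cp X₀ ξ j τ) atTop

/-- The lower asymptotic rate of waves longer than `j`. -/
def lowerWaveRate {Ω : Type*} [MeasurableSpace Ω] (P : Measure Ω) (cp : ℝ)
    (X₀ : Ω → ℕ → ℝ) (ξ : ℕ → ℕ → Ω → ℝ) (j : ℕ) : ℝ :=
  liminf (fun τ : ℕ => avgWaveProb P cp X₀ ξ j τ) atTop

end

/-!
Fix a customer and record their positions over time. Passing from each customer to the one behind
turns the queue into a system of coalescing random walks: the wave of step `t + 1` is a walk with
increments `d t 0, d t 1, …`, and it joins the configuration it finds (the walks of older waves)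
where it ends. The gap between a wave and the older walk it follows, at rank `i`, is the
`displacement` of the customer who gets this rank, and it is nonzero exactly while the wave lasts.

*Conservation.* At a fixed rank `j` the displacements telescope in time to the spacings at rank `j`
(`sum_displacement_mem`), so their time average lies between `cm` and `cp`. The claim thus says that
a displacement at rank `j`, given that it is nonzero, has order `√j`.

*Martingale structure.* As the rank grows, the gap changes by the difference of two fresh,
independent, centred steps: one of the wave itself and one (`headStep`) of the wave at the head of
the older walk. This fails only where that head joins a still older walk, or where the older walk is
the initial configuration. The second exception only matters for boundedly many steps, because a
customer of rank `j` is at distance at most `cp * j` (`exists_sum_unmoved_le`). For the first, each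
wave ends once and then perturbs at most one gap (`sum_headJoin_le`), so it costs `O(1)` per step.

*Upper bound.* Apply this to the convex function `(L - y)⁺ ^ 2` with `L` of order `√j`: the variance
of the increments shows that, per step, only `O(L)` of the ranks below `j` carry a gap smaller than
`L`, while by conservation only `O(j / L)` carry a larger one. So `O(√j)` of the events `i < W`,
`i < j`, happen on average, and these are decreasing in `i`
(`IsQueueInput.sum_integral_moves_le`).

*Lower bound.* Apply it to `huber L`, a quadratic function made linear beyond `L = K * √j`. Its mean
grows by a bounded amount per rank at which the wave is still alive, `O(√j)` in total, plus the
perturbations. A perturbation at rank `r` costs at most a constant times `min (cp * r) L`, and by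
the upper bound a wave is longer than `M` with frequency `O(1 / √M)`, so the perturbations cost
`O(M + L / √M)` per step. For `M` and `K` large constants, displacements above `L` contribute less
than half of the average displacement, and the remaining ones need frequency at least of order
`1 / L` (`exists_le_sum_integral_moves`).
-/

/-! ### One step of the queue -/

section Deterministic

variable {cm cp : ℝ} {x : ℕ → ℝ} {d : ℕ → ℕ → ℝ}

theorem lt_waveLength_iff (cp : ℝ) (x e : ℕ → ℝ) (i : ℕ) :
    (i : ℕ∞) < waveLength cp x e ↔
      ∀ m < i, ∑ k ∈ Finset.range m, e k < x (m + 2) - cp := by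
  have h : (i : ℕ∞) < waveLength cp x e ↔ ((i + 1 : ℕ) : ℕ∞) ≤ waveLength cp x e := by
    rw [Nat.cast_add, Nat.cast_one, ENat.add_one_le_iff (ENat.natCast_ne_top i)]
  rw [h, waveLength]
  simp only [le_iInf_iff, Nat.cast_le]
  constructor
  · intro H m hm
    by_contra! hc
    have := H m hc
    omega
  · intro H m hm
    by_contra! hc
    exact absurd (H m (by omega)) (not_lt.mpr hm)

theorem queueStep_of_lt {x e : ℕ → ℝ} {i : ℕ} (h : (i : ℕ∞) < waveLength cp x e) :
    queueStep cp x e i = ∑ k ∈ Finset.range i, e k := if_pos h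

theorem queueStep_of_not_lt {x e : ℕ → ℝ} {i : ℕ} (h : ¬ (i : ℕ∞) < waveLength cp x e) :
    queueStep cp x e i = x (i + 1) := if_neg h

theorem waveLength_lt_of_le {x e : ℕ → ℝ} {i k : ℕ} (h : (k : ℕ∞) < waveLength cp x e)
    (hik : i ≤ k) : (i : ℕ∞) < waveLength cp x e :=
  lt_of_le_of_lt (Nat.cast_le.mpr hik) h

theorem zero_lt_waveLength (cp : ℝ) (x e : ℕ → ℝ) : ((0 : ℕ) : ℕ∞) < waveLength cp x e :=
  (lt_waveLength_iff cp x e 0).mpr (by simp)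

theorem queueConfigs_iff (hcm : 0 < cm) :
    x ∈ queueConfigs cm cp ↔ x 0 = 0 ∧ ∀ i, x (i + 1) - x i ∈ Set.Icc cm cp := by
  refine ⟨fun h => ⟨h.1, h.2.2⟩, fun h => ⟨h.1, strictMono_nat_of_lt_succ fun i => ?_, h.2⟩⟩
  linarith [(h.2 i).1]

/-- At the end of a wave the first customer who stays is within distance `cp` of the last one who
moved. -/
theorem le_of_wave_end {x e : ℕ → ℝ} {i : ℕ} (h : (i : ℕ∞) < waveLength cp x e)
    (h' : ¬ ((i + 1 : ℕ) : ℕ∞) < waveLength cp x e) :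
    x (i + 2) - cp ≤ ∑ k ∈ Finset.range i, e k := by
  rw [lt_waveLength_iff] at h h'
  by_contra! hc
  refine h' fun m hm => ?_
  rcases Nat.lt_succ_iff_lt_or_eq.mp hm with h1 | rfl
  · exact h m h1
  · exact hc

theorem sum_lt_of_lt_waveLength {x e : ℕ → ℝ} {i : ℕ} (hcm : 0 < cm)
    (hx : x ∈ queueConfigs cm cp) (he : ∀ i, e i ∈ Set.Icc cm cp)
    (h : (i : ℕ∞) < waveLength cp x e) : ∑ k ∈ Finset.range i, e k < x (i + 1) := by
  rw [lt_waveLength_iff] at h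
  cases i with
  | zero =>
    have := (hx.2.2 0).1
    have h0 := hx.1
    simp only [Finset.range_zero, Finset.sum_empty]
    linarith
  | succ i =>
    rw [Finset.sum_range_succ]
    linarith [h i (Nat.lt_succ_self i), (he i).2]

theorem queueStep_mem {x e : ℕ → ℝ} (hcm : 0 < cm) (hx : x ∈ queueConfigs cm cp)
    (he : ∀ i, e i ∈ Set.Icc cm cp) : queueStep cp x e ∈ queueConfigs cm cp := by
  refine (queueConfigs_iff hcm).mpr ⟨?_, fun i => ?_⟩
  · rw [queueStep_of_lt (zero_lt_waveLength cp x e)]; simp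
  · by_cases h1 : ((i + 1 : ℕ) : ℕ∞) < waveLength cp x e
    · rw [queueStep_of_lt h1, queueStep_of_lt (waveLength_lt_of_le h1 (Nat.le_succ i)),
        Finset.sum_range_succ, add_sub_cancel_left]
      exact he i
    · rw [queueStep_of_not_lt h1]
      by_cases h0 : (i : ℕ∞) < waveLength cp x e
      · rw [queueStep_of_lt h0]
        have h2 := le_of_wave_end h0 h1
        have h3 := sum_lt_of_lt_waveLength hcm hx he h0
        have h4 := (hx.2.2 (i + 1)).1
        exact ⟨by linarith, by linarith⟩
      · rw [queueStep_of_not_lt h0]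
        exact hx.2.2 (i + 1)

theorem spatialQueue_mem (hcm : 0 < cm) (hx : x ∈ queueConfigs cm cp)
    (hd : ∀ t i, d t i ∈ Set.Icc cm cp) (t : ℕ) :
    spatialQueue cp x d t ∈ queueConfigs cm cp := by
  induction t with
  | zero => exact hx
  | succ t ih => exact queueStep_mem hcm ih (hd t)

theorem queueConfigs_bounds (hx : x ∈ queueConfigs cm cp) (k : ℕ) :
    x k ∈ Set.Icc (cm * k) (cp * k) := by
  induction k with
  | zero => simp [hx.1]
  | succ k ih =>
    have := hx.2.2 k
    push_cast
    exact ⟨by linarith [this.1, ih.1], by linarith [this.2, ih.2]⟩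

/-! ### Displacements -/

/-- The distance moved, at step number `t + 1`, by the customer whose new rank is `i`. -/
noncomputable def displacement (cp : ℝ) (x : ℕ → ℝ) (d : ℕ → ℕ → ℝ) (t i : ℕ) : ℝ :=
  spatialQueue cp x d t (i + 1) - spatialQueue cp x d (t + 1) i

theorem displacement_eq_zero {t i : ℕ} (h : ¬ (i : ℕ∞) < queueWave cp x d t) :
    displacement cp x d t i = 0 := by
  rw [displacement, spatialQueue, queueStep_of_not_lt h, sub_self]

theorem displacement_nonneg (hcm : 0 < cm) (hx : x ∈ queueConfigs cm cp)
    (hd : ∀ t i, d t i ∈ Set.Icc cm cp) (t i : ℕ) : 0 ≤ displacement cp x d t i := by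
  by_cases h : (i : ℕ∞) < queueWave cp x d t
  · rw [displacement, spatialQueue, queueStep_of_lt h]
    linarith [sum_lt_of_lt_waveLength hcm (spatialQueue_mem hcm hx hd t) (hd t) h]
  · rw [displacement_eq_zero h]

theorem displacement_le (hcm : 0 < cm) (hx : x ∈ queueConfigs cm cp)
    (hd : ∀ t i, d t i ∈ Set.Icc cm cp) (t i : ℕ) : displacement cp x d t i ≤ cp * (i + 1 : ℕ) := by
  have h1 := (queueConfigs_bounds (spatialQueue_mem hcm hx hd t) (i + 1)).2
  have h2 := (queueConfigs_bounds (spatialQueue_mem hcm hx hd (t + 1)) i).1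
  have : 0 ≤ cm * i := by positivity
  rw [displacement]
  linarith

/-- Displacements at a fixed rank add up to the spacings at that rank, up to a boundary term. -/
theorem sum_displacement (cp : ℝ) (x : ℕ → ℝ) (d : ℕ → ℕ → ℝ) (i τ : ℕ) :
    ∑ t ∈ Finset.range τ, displacement cp x d t i =
      ∑ t ∈ Finset.range τ, (spatialQueue cp x d t (i + 1) - spatialQueue cp x d t i)
        + (spatialQueue cp x d 0 i - spatialQueue cp x d τ i) := by
  induction τ with
  | zero => simp
  | succ τ ih => rw [Finset.sum_range_succ, Finset.sum_range_succ, ih, displacement]; ring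

theorem sum_displacement_mem (hcm : 0 < cm) (hx : x ∈ queueConfigs cm cp)
    (hd : ∀ t i, d t i ∈ Set.Icc cm cp) (i τ : ℕ) :
    ∑ t ∈ Finset.range τ, displacement cp x d t i ∈
      Set.Icc (cm * τ - cp * i) (cp * τ + cp * i) := by
  have hb := fun t => queueConfigs_bounds (spatialQueue_mem hcm hx hd t) i
  have hi : 0 ≤ cm * i := by positivity
  have hl : ∑ t ∈ Finset.range τ, cm ≤
      ∑ t ∈ Finset.range τ, (spatialQueue cp x d t (i + 1) - spatialQueue cp x d t i) :=
    Finset.sum_le_sum fun t _ => ((spatialQueue_mem hcm hx hd t).2.2 i).1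
  have hu : ∑ t ∈ Finset.range τ, (spatialQueue cp x d t (i + 1) - spatialQueue cp x d t i) ≤
      ∑ t ∈ Finset.range τ, cp :=
    Finset.sum_le_sum fun t _ => ((spatialQueue_mem hcm hx hd t).2.2 i).2
  simp only [Finset.sum_const, Finset.card_range, nsmul_eq_mul] at hl hu
  rw [sum_displacement]
  have h0 := hb 0
  have hτ := hb τ
  exact ⟨by linarith [h0.1, hτ.2], by linarith [h0.2, hτ.1]⟩

/-! ### Heads of paths

Follow a customer `n` through the queue: the positions `spatialQueue cp x d t (n - t)` decrease in
`t`, and as `n` grows they form a system of coalescing walks, the walk `t + 1` joining the walk `t`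
at the end of the wave of step `t + 1`. The walk through `spatialQueue cp x d t k` is, at that
moment, a continuation of the walk of the last wave that reached this customer, its head. -/

/-- The value at `spatialQueue cp x d t k` of a quantity `u` carried by the waves: if `s + 1 ≤ t` is
the last step at which the customer of rank `k` at time `t` moved, and `l` was their new rank
then, this is `u s l`. It is `v` if the customer has not moved yet. -/
noncomputable def headValue (cp : ℝ) (x : ℕ → ℝ) (d : ℕ → ℕ → ℝ) (u : ℕ → ℕ → ℝ) (v : ℝ) :
    ℕ → ℕ → ℝ
  | 0, _ => v
  | t + 1, k => if (k : ℕ∞) < queueWave cp x d t then u t k else headValue cp x d u v t (k + 1)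

/-- The stopping distance that the walk through `spatialQueue cp x d t k` would use next. For the
walk of the initial configuration, the value `1` is a convention. -/
noncomputable abbrev headStep (cp : ℝ) (x : ℕ → ℝ) (d : ℕ → ℕ → ℝ) : ℕ → ℕ → ℝ :=
  headValue cp x d d 1

/-- For `k` below the length of the wave of step `t + 1`: the weight `p (k + 1)` if this wave ends
there, that is, has length `k + 1`, and `0` otherwise. -/
noncomputable def waveEnd (cp : ℝ) (x : ℕ → ℝ) (d : ℕ → ℕ → ℝ) (p : ℕ → ℝ) (t k : ℕ) : ℝ :=
  if ((k + 1 : ℕ) : ℕ∞) < queueWave cp x d t then 0 else p (k + 1)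

/-- If the head of the walk through `spatialQueue cp x d t k` joins an older walk at the next
customer, the weight `p l` of the rank `l` at which this happens; otherwise `0`. -/
noncomputable abbrev headJoin (cp : ℝ) (x : ℕ → ℝ) (d : ℕ → ℕ → ℝ) (p : ℕ → ℝ) : ℕ → ℕ → ℝ :=
  headValue cp x d (waveEnd cp x d p) 0

/-- The indicator of the customer of rank `k` at time `t` not having moved yet. -/
noncomputable abbrev unmoved (cp : ℝ) (x : ℕ → ℝ) (d : ℕ → ℕ → ℝ) : ℕ → ℕ → ℝ :=
  headValue cp x d (fun _ _ => 0) 1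

theorem headValue_mem {u : ℕ → ℕ → ℝ} {v : ℝ} {s : Set ℝ} (hu : ∀ t k, u t k ∈ s) (hv : v ∈ s)
    (t k : ℕ) : headValue cp x d u v t k ∈ s := by
  induction t generalizing k with
  | zero => exact hv
  | succ t ih =>
    rw [headValue]
    split_ifs
    · exact hu t k
    · exact ih (k + 1)

theorem waveEnd_nonneg {p : ℕ → ℝ} (hp : ∀ k, 0 ≤ p k) (t k : ℕ) : 0 ≤ waveEnd cp x d p t k := by
  rw [waveEnd]
  split_ifs
  · exact le_rfl
  · exact hp _

theorem headJoin_nonneg {p : ℕ → ℝ} (hp : ∀ k, 0 ≤ p k) (t k : ℕ) : 0 ≤ headJoin cp x d p t k :=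
  headValue_mem (s := Set.Ici 0) (waveEnd_nonneg hp) (Set.mem_Ici.mpr le_rfl) t k

theorem unmoved_mem (t k : ℕ) : unmoved cp x d t k ∈ Set.Icc (0 : ℝ) 1 :=
  headValue_mem (by simp) (by simp) t k

/-- A customer of rank `k` stands between `cm * k` and `cp * k`, so one who started far away must
have moved. -/
theorem unmoved_eq_zero (hcm : 0 < cm) (hx : x ∈ queueConfigs cm cp)
    (hd : ∀ t i, d t i ∈ Set.Icc cm cp) {t k : ℕ} (h : cp * k < cm * (t + k : ℕ)) :
    unmoved cp x d t k = 0 := by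
  have key : ∀ t k : ℕ, unmoved cp x d t k = 0 ∨ spatialQueue cp x d t k = x (t + k) := by
    intro t
    induction t with
    | zero => intro k; right; simp [spatialQueue]
    | succ t ih =>
      intro k
      simp only [unmoved, headValue]
      by_cases hk : (k : ℕ∞) < queueWave cp x d t
      · left; rw [if_pos hk]
      · rw [if_neg hk, spatialQueue, queueStep_of_not_lt hk, show t + 1 + k = t + (k + 1) by ring]
        exact ih (k + 1)
  rcases key t k with h0 | h1
  · exact h0
  · have h2 := (queueConfigs_bounds (spatialQueue_mem hcm hx hd t) k).2
    have h3 := (queueConfigs_bounds hx (t + k)).1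
    linarith

/-- The walk through `spatialQueue cp x d t k` makes the step `headStep`, unless it joins another
walk or belongs to the initial configuration. -/
theorem abs_spacing_sub_headStep_le (hcm : 0 < cm) (h1 : (1 : ℝ) ∈ Set.Icc cm cp)
    (hx : x ∈ queueConfigs cm cp) (hd : ∀ t i, d t i ∈ Set.Icc cm cp) (t k : ℕ) :
    |spatialQueue cp x d t (k + 1) - spatialQueue cp x d t k - headStep cp x d t k| ≤
      cp * (headJoin cp x d (fun _ => 1) t k + unmoved cp x d t k) := by
  have habs : ∀ {a b : ℝ}, a ∈ Set.Icc cm cp → b ∈ Set.Icc cm cp → |a - b| ≤ cp := by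
    intro a b ha hb
    rw [abs_le]
    exact ⟨by linarith [ha.1, hb.2], by linarith [ha.2, hb.1]⟩
  induction t generalizing k with
  | zero =>
    simp only [headStep, headJoin, unmoved, headValue, zero_add, mul_one]
    exact habs (hx.2.2 k) h1
  | succ t ih =>
    have hgap := (spatialQueue_mem hcm hx hd (t + 1)).2.2 k
    simp only [headStep, headJoin, unmoved, headValue] at ih ⊢
    by_cases hk : (k : ℕ∞) < queueWave cp x d t
    · simp only [if_pos hk]
      by_cases hk1 : ((k + 1 : ℕ) : ℕ∞) < queueWave cp x d t
      · rw [waveEnd, if_pos hk1, spatialQueue, queueStep_of_lt hk, queueStep_of_lt hk1,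
          Finset.sum_range_succ, add_sub_cancel_left, sub_self]
        simp
      · rw [waveEnd, if_neg hk1, add_zero, mul_one]
        exact habs hgap (hd t k)
    · have hk1 : ¬ ((k + 1 : ℕ) : ℕ∞) < queueWave cp x d t := fun h =>
        hk (waveLength_lt_of_le h (Nat.le_succ k))
      simp only [if_neg hk]
      rw [spatialQueue, queueStep_of_not_lt hk, queueStep_of_not_lt hk1]
      exact ih (k + 1)

/-- The head of the walk joins at a rank larger than `k`, where a monotone weight is at least
`p k`. -/
theorem mul_headJoin_one_le {p : ℕ → ℝ} (hp : Monotone p) (t k : ℕ) :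
    p k * headJoin cp x d (fun _ => 1) t k ≤ headJoin cp x d p t k := by
  have h01 : ∀ t k, headJoin cp x d (fun _ => 1) t k ∈ Set.Ici (0 : ℝ) :=
    fun t k => headJoin_nonneg (fun _ => zero_le_one) t k
  induction t generalizing k with
  | zero => simp [headJoin, headValue]
  | succ t ih =>
    have h2 := ih (k + 1)
    have h3 := h01 t (k + 1)
    simp only [headJoin, headValue] at h2 h3 ⊢
    split_ifs with hk
    · simp only [waveEnd]
      split_ifs
      · simp
      · rw [mul_one]; exact hp (Nat.le_succ k)
    · exact (mul_le_mul_of_nonneg_right (hp (Nat.le_succ k)) h3).trans h2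

/-- The indicator of the customer of new rank `i` moving at step number `t + 1`. -/
noncomputable def moves (cp : ℝ) (x : ℕ → ℝ) (d : ℕ → ℕ → ℝ) (t i : ℕ) : ℝ :=
  if (i : ℕ∞) < queueWave cp x d t then 1 else 0

theorem moves_mem (t i : ℕ) : moves cp x d t i ∈ Set.Icc (0 : ℝ) 1 := by
  rw [moves]; split_ifs <;> simp

theorem moves_mul_displacement (t i : ℕ) :
    moves cp x d t i * displacement cp x d t i = displacement cp x d t i := by
  by_cases h : (i : ℕ∞) < queueWave cp x d t
  · rw [moves, if_pos h, one_mul]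
  · rw [displacement_eq_zero h, mul_zero]

theorem displacement_zero_le (hcm : 0 < cm) (hx : x ∈ queueConfigs cm cp)
    (hd : ∀ t i, d t i ∈ Set.Icc cm cp) (t : ℕ) : displacement cp x d t 0 ≤ cp := by
  have := displacement_le hcm hx hd t 0
  simpa using this

/-- Each time a customer moves, the quantity carried by their position is replaced by a new one. -/
theorem sum_headValue (u : ℕ → ℕ → ℝ) (v : ℝ) (n T : ℕ) (hT : T ≤ n) :
    ∑ t ∈ Finset.range T, moves cp x d t (n - 1 - t) * headValue cp x d u v t (n - t)
        + headValue cp x d u v T (n - T) =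
      v + ∑ t ∈ Finset.range T, moves cp x d t (n - 1 - t) * u t (n - 1 - t) := by
  induction T with
  | zero => simp [headValue]
  | succ T ih =>
    have ih := ih (by omega)
    have e1 : n - (T + 1) = n - 1 - T := by omega
    have e2 : n - 1 - T + 1 = n - T := by omega
    rw [Finset.sum_range_succ, Finset.sum_range_succ, ← add_assoc, ← ih, headValue, e1, moves]
    split_ifs
    · ring
    · rw [e2]; ring

/-- The weight of the length of the wave of step `t + 1`, cut off at rank `N`. -/
noncomputable def waveWeight (cp : ℝ) (x : ℕ → ℝ) (d : ℕ → ℕ → ℝ) (p : ℕ → ℝ) (N t : ℕ) : ℝ :=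
  ∑ i ∈ Finset.range N, moves cp x d t i * waveEnd cp x d p t i

/-- At most one rank contributes to `waveWeight`. -/
theorem waveWeight_le {p : ℕ → ℝ} {c : ℝ} (N t : ℕ) (hc : 0 ≤ c)
    (h : ∀ i : ℕ, (i : ℕ∞) < queueWave cp x d t → ¬ ((i + 1 : ℕ) : ℕ∞) < queueWave cp x d t →
      p (i + 1) ≤ c) : waveWeight cp x d p N t ≤ c := by
  rw [waveWeight]
  have key : ∀ N, ∑ i ∈ Finset.range N, moves cp x d t i * waveEnd cp x d p t i ≤
      if (N : ℕ∞) < queueWave cp x d t then 0 else c := by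
    intro N
    induction N with
    | zero => simp only [Finset.range_zero, Finset.sum_empty]; split_ifs <;> simp [hc]
    | succ N ih =>
      rw [Finset.sum_range_succ]
      by_cases hN : (N : ℕ∞) < queueWave cp x d t
      · rw [if_pos hN] at ih
        by_cases hN1 : ((N + 1 : ℕ) : ℕ∞) < queueWave cp x d t
        · rw [waveEnd, if_pos hN1, if_pos hN1]; simpa using ih
        · rw [waveEnd, if_neg hN1, if_neg hN1, moves, if_pos hN]
          linarith [h N hN hN1]
      · have hN1 : ¬ ((N + 1 : ℕ) : ℕ∞) < queueWave cp x d t := fun h =>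
          hN (waveLength_lt_of_le h (Nat.le_succ N))
        rw [if_neg hN] at ih
        rw [moves, if_neg hN, if_neg hN1]
        linarith
  refine (key N).trans ?_
  split_ifs
  · exact hc
  · exact le_rfl

/-- Every wave end perturbs the increments of at most one displacement. -/
theorem sum_headJoin_le {p : ℕ → ℝ} (hp : ∀ k, 0 ≤ p k) (τ j : ℕ) :
    ∑ t ∈ Finset.range τ, ∑ i ∈ Finset.range j, moves cp x d t i * headJoin cp x d p t (i + 1) ≤
      ∑ t ∈ Finset.range τ, waveWeight cp x d p (τ + j) t := by
  have hm : ∀ t i, 0 ≤ moves cp x d t i := fun t i => (moves_mem t i).1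
  -- reindex by the customer `n = t + i + 1`
  set F : ℕ → ℕ → ℝ := fun t n =>
    if t < n then moves cp x d t (n - 1 - t) * headJoin cp x d p t (n - t) else 0 with hF
  set G : ℕ → ℕ → ℝ := fun t n =>
    if t < n then moves cp x d t (n - 1 - t) * waveEnd cp x d p t (n - 1 - t) else 0 with hG
  have hF0 : ∀ t n, 0 ≤ F t n := by
    intro t n
    simp only [hF]
    split_ifs
    · exact mul_nonneg (hm _ _) (headJoin_nonneg hp _ _)
    · exact le_rfl
  have step1 : ∀ t ∈ Finset.range τ,
      ∑ i ∈ Finset.range j, moves cp x d t i * headJoin cp x d p t (i + 1) ≤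
        ∑ n ∈ Finset.range (τ + j), F t n := by
    intro t ht
    rw [Finset.mem_range] at ht
    have hsub : (Finset.range j).image (fun i => t + i + 1) ⊆ Finset.range (τ + j) := by
      intro n hn
      simp only [Finset.mem_image, Finset.mem_range] at hn ⊢
      obtain ⟨i, hi, rfl⟩ := hn
      omega
    refine le_trans (le_of_eq ?_) (Finset.sum_le_sum_of_subset_of_nonneg hsub fun n _ _ => hF0 t n)
    rw [Finset.sum_image (fun a _ b _ hab => by simpa using hab)]
    refine Finset.sum_congr rfl fun i _ => ?_
    simp only [hF]
    rw [if_pos (by omega), show t + i + 1 - 1 - t = i by omega, show t + i + 1 - t = i + 1 by omega]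
  have step2 : ∀ n, ∑ t ∈ Finset.range τ, F t n ≤ ∑ t ∈ Finset.range τ, G t n := by
    intro n
    have hcut : ∀ H : ℕ → ℝ, ∑ t ∈ Finset.range τ, (if t < n then H t else 0) =
        ∑ t ∈ Finset.range (min τ n), H t := by
      intro H
      rw [← Finset.sum_filter]
      congr 1
      ext t
      simp
    simp only [hF, hG]
    rw [hcut, hcut]
    have h1 := sum_headValue (cp := cp) (x := x) (d := d) (waveEnd cp x d p) 0 n (min τ n)
      (min_le_right _ _)
    have h2 : 0 ≤ headValue cp x d (waveEnd cp x d p) 0 (min τ n) (n - min τ n) :=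
      headJoin_nonneg hp _ _
    linarith
  have step3 : ∀ t ∈ Finset.range τ,
      ∑ n ∈ Finset.range (τ + j), G t n ≤ waveWeight cp x d p (τ + j) t := by
    intro t _
    have hsub : ((Finset.range (τ + j)).filter fun n => t < n) ⊆
        (Finset.range (τ + j)).image (fun i => t + i + 1) := by
      intro n hn
      simp only [Finset.mem_image, Finset.mem_range, Finset.mem_filter] at hn ⊢
      exact ⟨n - 1 - t, by omega, by omega⟩
    simp only [hG]
    rw [← Finset.sum_filter]
    refine (Finset.sum_le_sum_of_subset_of_nonneg hsub fun n _ _ =>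
      mul_nonneg (hm _ _) (waveEnd_nonneg hp _ _)).trans (le_of_eq ?_)
    rw [Finset.sum_image (fun a _ b _ hab => by simpa using hab), waveWeight]
    refine Finset.sum_congr rfl fun i _ => ?_
    rw [show t + i + 1 - 1 - t = i by omega]
  calc _ ≤ ∑ t ∈ Finset.range τ, ∑ n ∈ Finset.range (τ + j), F t n := Finset.sum_le_sum step1
    _ = ∑ n ∈ Finset.range (τ + j), ∑ t ∈ Finset.range τ, F t n := Finset.sum_comm
    _ ≤ ∑ n ∈ Finset.range (τ + j), ∑ t ∈ Finset.range τ, G t n :=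
        Finset.sum_le_sum fun n _ => step2 n
    _ = ∑ t ∈ Finset.range τ, ∑ n ∈ Finset.range (τ + j), G t n := Finset.sum_comm
    _ ≤ _ := Finset.sum_le_sum step3

/-- Only boundedly many steps involve customers of rank at most `j` who have not moved yet. -/
theorem exists_sum_unmoved_le (hcm : 0 < cm) (cp : ℝ) (j : ℕ) :
    ∃ B : ℝ, 0 ≤ B ∧ ∀ x ∈ queueConfigs cm cp, ∀ d : ℕ → ℕ → ℝ, (∀ t i, d t i ∈ Set.Icc cm cp) →
      ∀ τ, ∑ t ∈ Finset.range τ, ∑ i ∈ Finset.range j, unmoved cp x d t (i + 1) ≤ B := by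
  obtain ⟨N, hN⟩ := exists_nat_gt (|cp| * j / cm)
  refine ⟨N * j, by positivity, fun x hx d hd τ => ?_⟩
  have hterm : ∀ t, ∑ i ∈ Finset.range j, unmoved cp x d t (i + 1) ≤
      if t < N then (j : ℝ) else 0 := by
    intro t
    split_ifs with h
    · refine (Finset.sum_le_sum fun i _ => (unmoved_mem t (i + 1)).2).trans ?_
      simp
    · refine (Finset.sum_eq_zero fun i hi => unmoved_eq_zero hcm hx hd ?_).le
      rw [Finset.mem_range] at hi
      rw [div_lt_iff₀ hcm] at hN
      have h1 : ((i + 1 : ℕ) : ℝ) ≤ j := by exact_mod_cast hi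
      have h2 : (N : ℝ) ≤ t := by exact_mod_cast not_lt.mp h
      have h3 : cp * (i + 1 : ℕ) ≤ |cp| * j :=
        (mul_le_mul_of_nonneg_right (le_abs_self cp) (by positivity)).trans
          (mul_le_mul_of_nonneg_left h1 (abs_nonneg _))
      have h4 : cm * N ≤ cm * t := mul_le_mul_of_nonneg_left h2 hcm.le
      have h5 : 0 ≤ cm * (i + 1 : ℕ) := by positivity
      rw [Nat.cast_add t, mul_add]
      linarith
  refine (Finset.sum_le_sum fun t _ => hterm t).trans ?_
  rw [← Finset.sum_filter, Finset.sum_const, nsmul_eq_mul]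
  refine mul_le_mul_of_nonneg_right ?_ (by positivity)
  have : ((Finset.range τ).filter fun t => t < N) ⊆ Finset.range N := by
    intro t ht
    simp only [Finset.mem_filter, Finset.mem_range] at ht ⊢
    exact ht.2
  simpa using Nat.cast_le (α := ℝ).mpr (Finset.card_le_card this)

/-! ### Two test functions of the displacement -/

theorem sq_posPart_convex_bound (L y z c : ℝ) (hz : |z| ≤ c) :
    (max (L - y) 0) ^ 2 - 2 * max (L - y) 0 * z + (if y ≤ L - c then z ^ 2 else 0) ≤
      (max (L - (y + z)) 0) ^ 2 := by
  have hz' := abs_le.mp hz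
  split_ifs with h
  · rw [max_eq_left (by linarith : 0 ≤ L - y), max_eq_left (by linarith : 0 ≤ L - (y + z))]
    apply le_of_eq; ring
  · rcases le_total 0 (L - y) with h1 | h1 <;> rcases le_total 0 (L - (y + z)) with h2 | h2
    · rw [max_eq_left h1, max_eq_left h2]; nlinarith [sq_nonneg z]
    · rw [max_eq_left h1, max_eq_right h2]; nlinarith
    · rw [max_eq_right h1, max_eq_left h2]; nlinarith
    · rw [max_eq_right h1, max_eq_right h2]; simp

theorem sq_posPart_sub_le (L y y' c b : ℝ) (hc : L + c ≤ b) (hb : 0 ≤ b) (hy : -c ≤ y)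
    (hy' : -c ≤ y') :
    (max (L - y) 0) ^ 2 - (max (L - y') 0) ^ 2 ≤ 2 * b * |y' - y| := by
  have h1 : max (L - y) 0 - max (L - y') 0 ≤ |y' - y| := by
    have := abs_max_sub_max_le_abs (L - y) (L - y') 0
    calc _ ≤ |max (L - y) 0 - max (L - y') 0| := le_abs_self _
      _ ≤ |L - y - (L - y')| := this
      _ = |y' - y| := by congr 1; ring
  have ha : max (L - y) 0 ≤ b := max_le (by linarith) hb
  have ha' : max (L - y') 0 ≤ b := max_le (by linarith) hb
  have h0 : 0 ≤ max (L - y) 0 := le_max_right _ _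
  have h0' : 0 ≤ max (L - y') 0 := le_max_right _ _
  have hn := abs_nonneg (y' - y)
  nlinarith

/-- The function equal to `y ^ 2` up to `L` and continued linearly beyond. -/
noncomputable def huber (L y : ℝ) : ℝ := y ^ 2 - (max (y - L) 0) ^ 2

theorem huber_nonneg {L : ℝ} (hL : 0 ≤ L) (y : ℝ) : 0 ≤ huber L y := by
  rw [huber]
  rcases le_total 0 (y - L) with h | h
  · rw [max_eq_left h]; nlinarith
  · rw [max_eq_right h]; nlinarith

theorem huber_add_le (L y z : ℝ) : huber L (y + z) ≤ huber L y + 2 * min y L * z + z ^ 2 := by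
  rw [huber, huber]
  rcases le_total 0 (y - L) with h1 | h1 <;> rcases le_total 0 (y + z - L) with h2 | h2
  · rw [max_eq_left h1, max_eq_left h2, min_eq_right (by linarith)]; nlinarith
  · rw [max_eq_left h1, max_eq_right h2, min_eq_right (by linarith)]; nlinarith
  · rw [max_eq_right h1, max_eq_left h2, min_eq_left (by linarith)]; nlinarith
  · rw [max_eq_right h1, max_eq_right h2, min_eq_left (by linarith)]; nlinarith

theorem le_huber_of_le {L y : ℝ} (hL : 0 ≤ L) (h : L ≤ y) : L * y ≤ huber L y := by
  rw [huber, max_eq_left (by linarith)]; nlinarith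

theorem displacement_succ {t i : ℕ} (h : ((i + 1 : ℕ) : ℕ∞) < queueWave cp x d t) :
    displacement cp x d t (i + 1) = displacement cp x d t i
      + (spatialQueue cp x d t (i + 2) - spatialQueue cp x d t (i + 1)) - d t i := by
  rw [displacement, displacement, spatialQueue, queueStep_of_lt h,
    queueStep_of_lt (waveLength_lt_of_le h (Nat.le_succ i)), Finset.sum_range_succ]
  ring

/-- The square of the positive part of `L - displacement` is nearly a submartingale in the rank:
walks behave like independent walks with increments `headStep` and `d t i`, up to corrections
at the places where walks join. -/
theorem moves_mul_sq_posPart_le (hcm : 0 < cm) (h1 : (1 : ℝ) ∈ Set.Icc cm cp)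
    (hx : x ∈ queueConfigs cm cp) (hd : ∀ t i, d t i ∈ Set.Icc cm cp) {L : ℝ} (hL : cp ≤ L)
    (t i : ℕ) :
    (max (L - displacement cp x d t i) 0) ^ 2
        - moves cp x d t i * (2 * max (L - displacement cp x d t i) 0)
          * (headStep cp x d t (i + 1) - d t i)
        + moves cp x d t i * (if displacement cp x d t i ≤ L - cp then 1 else 0)
          * (headStep cp x d t (i + 1) - d t i) ^ 2
      ≤ (max (L - displacement cp x d t (i + 1)) 0) ^ 2
        + 4 * L * cp * (moves cp x d t i * waveEnd cp x d (fun _ => 1) t i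
          + moves cp x d t i * headJoin cp x d (fun _ => 1) t (i + 1)
          + unmoved cp x d t (i + 1)) := by
  have hcp : 0 < cp := by linarith [h1.1, h1.2]
  have hD := displacement_nonneg hcm hx hd t i
  have hD' := displacement_nonneg hcm hx hd t (i + 1)
  have hη : headStep cp x d t (i + 1) ∈ Set.Icc cm cp := headValue_mem hd h1 t (i + 1)
  have hgap := abs_spacing_sub_headStep_le hcm h1 hx hd t (i + 1)
  have hg := (spatialQueue_mem hcm hx hd t).2.2 (i + 1)
  have hκ := headJoin_nonneg (cp := cp) (x := x) (d := d) (p := fun _ => 1)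
    (fun _ => zero_le_one) t (i + 1)
  have hu := (unmoved_mem (cp := cp) (x := x) (d := d) t (i + 1)).1
  have hξ := hd t i
  set D := displacement cp x d t i
  set η := headStep cp x d t (i + 1)
  set κ := headJoin cp x d (fun _ => 1) t (i + 1)
  set v := unmoved cp x d t (i + 1)
  set g := spatialQueue cp x d t (i + 1 + 1) - spatialQueue cp x d t (i + 1) with hgdef
  have hz : |η - d t i| ≤ cp := by
    rw [abs_le]; exact ⟨by linarith [hη.1, hξ.2], by linarith [hη.2, hξ.1]⟩
  by_cases ha : (i : ℕ∞) < queueWave cp x d t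
  · have hm : moves cp x d t i = 1 := if_pos ha
    simp only [hm, one_mul]
    have hconv := sq_posPart_convex_bound L D (η - d t i) cp hz
    rw [ite_mul, one_mul, zero_mul]
    have hLcp : 0 ≤ L * cp := mul_nonneg (hcp.le.trans hL) hcp.le
    by_cases ha1 : ((i + 1 : ℕ) : ℕ∞) < queueWave cp x d t
    · have hs : displacement cp x d t (i + 1) = D + g - d t i := displacement_succ ha1
      have hw : waveEnd cp x d (fun _ => 1) t i = 0 := if_pos ha1
      have hlip := sq_posPart_sub_le L (D + (η - d t i)) (D + g - d t i) cp (2 * L) (by linarith)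
        (by linarith) (by linarith [hη.1, hξ.2]) (by linarith [hg.1, hξ.2])
      rw [show D + g - d t i - (D + (η - d t i)) = g - η by ring] at hlip
      rw [hs, hw]
      have : 2 * (2 * L) * |g - η| ≤ 2 * (2 * L) * (cp * (κ + v)) :=
        mul_le_mul_of_nonneg_left hgap (by linarith)
      linarith
    · have hs : displacement cp x d t (i + 1) = 0 := displacement_eq_zero ha1
      have hw : waveEnd cp x d (fun _ => 1) t i = 1 := if_neg ha1
      have hlip := sq_posPart_sub_le L (max (-cp) (min 0 (D + (η - d t i)))) 0 cp (2 * L)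
        (by linarith) (by linarith) (le_max_left _ _) (by linarith)
      have hle : (max (L - (D + (η - d t i))) 0) ^ 2 ≤
          (max (L - max (-cp) (min 0 (D + (η - d t i)))) 0) ^ 2 := by
        refine pow_le_pow_left₀ (le_max_right _ _) (max_le_max ?_ le_rfl) 2
        have : max (-cp) (min 0 (D + (η - d t i))) ≤ D + (η - d t i) :=
          max_le (by linarith [hη.1, hξ.2]) (min_le_right _ _)
        linarith
      have habs : |0 - max (-cp) (min 0 (D + (η - d t i)))| ≤ cp := by
        rw [zero_sub, abs_neg, abs_le]
        exact ⟨le_max_left _ _, max_le (by linarith) ((min_le_left _ _).trans hcp.le)⟩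
      rw [hs, hw]
      have h5 : 2 * (2 * L) * |0 - max (-cp) (min 0 (D + (η - d t i)))| ≤ 2 * (2 * L) * cp :=
        mul_le_mul_of_nonneg_left habs (by linarith)
      have h6 : 0 ≤ L * cp * (κ + v) := mul_nonneg hLcp (by linarith)
      linarith
  · have ha1 : ¬ ((i + 1 : ℕ) : ℕ∞) < queueWave cp x d t := fun h =>
      ha (waveLength_lt_of_le h (Nat.le_succ i))
    have hm : moves cp x d t i = 0 := if_neg ha
    have hs : displacement cp x d t (i + 1) = 0 := displacement_eq_zero ha1
    have hs0 : D = 0 := displacement_eq_zero ha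
    rw [hm, hs, hs0]
    have : 0 ≤ L * cp * v := mul_nonneg (mul_nonneg (hcp.le.trans hL) hcp.le) hu
    linarith

/-- The truncated square of the displacement is nearly a supermartingale in the rank, apart from a
bounded growth while the walks are distinct. -/
theorem huber_displacement_succ_le (hcm : 0 < cm) (h1 : (1 : ℝ) ∈ Set.Icc cm cp)
    (hx : x ∈ queueConfigs cm cp) (hd : ∀ t i, d t i ∈ Set.Icc cm cp) {L : ℝ} (hL : 0 ≤ L)
    (t i : ℕ) :
    huber L (displacement cp x d t (i + 1)) ≤ huber L (displacement cp x d t i)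
        + moves cp x d t i * (2 * min (displacement cp x d t i) L)
          * (headStep cp x d t (i + 1) - d t i)
        + cp ^ 2 * moves cp x d t i
        + 2 * cp * (moves cp x d t i * headJoin cp x d (fun k => min (cp * k) L) t (i + 1)
          + L * unmoved cp x d t (i + 1)) := by
  have hcp : 0 < cp := by linarith [h1.1, h1.2]
  have hD := displacement_nonneg hcm hx hd t i
  have hDle := displacement_le hcm hx hd t i
  have hη : headStep cp x d t (i + 1) ∈ Set.Icc cm cp := headValue_mem hd h1 t (i + 1)
  have hgap := abs_spacing_sub_headStep_le hcm h1 hx hd t (i + 1)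
  have hg := (spatialQueue_mem hcm hx hd t).2.2 (i + 1)
  have hκ := headJoin_nonneg (cp := cp) (x := x) (d := d) (p := fun _ => 1)
    (fun _ => zero_le_one) t (i + 1)
  have hmono : Monotone fun k : ℕ => min (cp * k) L := fun a b hab =>
    min_le_min_right _ (mul_le_mul_of_nonneg_left (Nat.cast_le.mpr hab) hcp.le)
  have hκp := mul_headJoin_one_le (cp := cp) (x := x) (d := d) hmono t (i + 1)
  have hu := (unmoved_mem (cp := cp) (x := x) (d := d) t (i + 1)).1
  have hξ := hd t i
  set D := displacement cp x d t i
  set η := headStep cp x d t (i + 1)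
  set κ := headJoin cp x d (fun _ => 1) t (i + 1)
  set κp := headJoin cp x d (fun k => min (cp * k) L) t (i + 1)
  set v := unmoved cp x d t (i + 1)
  set g := spatialQueue cp x d t (i + 1 + 1) - spatialQueue cp x d t (i + 1) with hgdef
  have hsq : ∀ a ∈ Set.Icc cm cp, (a - d t i) ^ 2 ≤ cp ^ 2 := fun a ha =>
    sq_le_sq' (by linarith [ha.1, hξ.2]) (by linarith [ha.2, hξ.1])
  have hmin : 0 ≤ min D L := le_min hD hL
  have hjoin : min D L * κ ≤ κp :=
    (mul_le_mul_of_nonneg_right (min_le_min_right L hDle) hκ).trans hκp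
  have hLv : min D L * v ≤ L * v := mul_le_mul_of_nonneg_right (min_le_right _ _) hu
  by_cases ha : (i : ℕ∞) < queueWave cp x d t
  · have hm : moves cp x d t i = 1 := if_pos ha
    simp only [hm, one_mul, mul_one]
    by_cases ha1 : ((i + 1 : ℕ) : ℕ∞) < queueWave cp x d t
    · have hs : displacement cp x d t (i + 1) = D + (g - d t i) := by
        rw [displacement_succ ha1]; ring
      have hb := huber_add_le L D (g - d t i)
      have h4 : min D L * (g - η) ≤ min D L * (cp * (κ + v)) :=
        mul_le_mul_of_nonneg_left ((le_abs_self _).trans hgap) hmin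
      have h5 := hsq g hg
      have h6 : cp * (min D L * κ + min D L * v) ≤ cp * (κp + L * v) :=
        mul_le_mul_of_nonneg_left (by linarith) hcp.le
      rw [hs]
      linarith
    · have hs : displacement cp x d t (i + 1) = 0 := displacement_eq_zero ha1
      have hb := huber_add_le L D (η - d t i)
      have hn := huber_nonneg hL (D + (η - d t i))
      have h0 : huber L 0 = 0 := by rw [huber, max_eq_right (by linarith)]; simp
      have h5 := hsq η hη
      have h6 : 0 ≤ cp * (κp + L * v) :=
        mul_nonneg hcp.le (add_nonneg ((mul_nonneg hmin hκ).trans hjoin) (mul_nonneg hL hu))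
      rw [hs, h0]
      linarith
  · have ha1 : ¬ ((i + 1 : ℕ) : ℕ∞) < queueWave cp x d t := fun h =>
      ha (waveLength_lt_of_le h (Nat.le_succ i))
    have hm : moves cp x d t i = 0 := if_neg ha
    have hs : displacement cp x d t (i + 1) = 0 := displacement_eq_zero ha1
    have hs0 : D = 0 := displacement_eq_zero ha
    rw [hm, hs, hs0]
    have : 0 ≤ cp * (L * v) := mul_nonneg hcp.le (mul_nonneg hL hu)
    linarith

end Deterministic

/-! ### Random input -/

/-- The initial configuration `X₀` and the stopping distances `d` are independent, and the latter
are i.i.d. with mean `1`, variance `v` and values in `[cm, cp]` everywhere. -/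
structure IsQueueInput {Ω : Type*} [MeasurableSpace Ω] (P : Measure Ω) (cm cp v : ℝ)
    (X₀ : Ω → ℕ → ℝ) (d : Ω → ℕ → ℕ → ℝ) : Prop where
  measurable_init : Measurable X₀
  init_mem : ∀ ω, X₀ ω ∈ queueConfigs cm cp
  measurable_step : ∀ t i, Measurable fun ω => d ω t i
  step_mem : ∀ ω t i, d ω t i ∈ Set.Icc cm cp
  integral_step : ∀ t i, ∫ ω, d ω t i ∂P = 1
  integral_sq : ∀ t i, ∫ ω, (d ω t i - 1) ^ 2 ∂P = v
  iIndepFun_step : iIndepFun (fun (p : ℕ × ℕ) ω => d ω p.1 p.2) P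
  indepFun_init : IndepFun X₀ (fun ω (p : ℕ × ℕ) => d ω p.1 p.2) P

section Random

variable {Ω : Type*}

/-- The information in the initial configuration and in the stopping distances indexed by `A`. -/
@[reducible]
def inputSigma (X₀ : Ω → ℕ → ℝ) (d : Ω → ℕ → ℕ → ℝ) (A : Set (ℕ × ℕ)) : MeasurableSpace Ω :=
  MeasurableSpace.comap X₀ inferInstance ⊔
    ⨆ p ∈ A, MeasurableSpace.comap (fun ω => d ω p.1 p.2) inferInstance

/-- The stopping distances that determine the motion of the first `n` customers. -/
def customerSteps (n : ℕ) : Set (ℕ × ℕ) := {p | p.1 + p.2 + 2 ≤ n}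

variable {X₀ : Ω → ℕ → ℝ} {d : Ω → ℕ → ℕ → ℝ} {cm cp v : ℝ}

theorem inputSigma_mono {A B : Set (ℕ × ℕ)} (h : A ⊆ B) :
    inputSigma X₀ d A ≤ inputSigma X₀ d B :=
  sup_le_sup_left (biSup_mono h) _

theorem customerSteps_mono {m n : ℕ} (h : m ≤ n) : customerSteps m ⊆ customerSteps n :=
  fun _ hp => le_trans (Set.mem_ofPred.mp hp) h

theorem measurable_step_inputSigma {A : Set (ℕ × ℕ)} {t i : ℕ} (h : (t, i) ∈ A) :
    Measurable[inputSigma X₀ d A] fun ω => d ω t i := by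
  refine Measurable.mono (comap_measurable (fun ω => d ω t i)) ?_ le_rfl
  exact le_sup_of_le_right (le_iSup₂_of_le (t, i) h le_rfl)

theorem measurable_init_inputSigma (A : Set (ℕ × ℕ)) (k : ℕ) :
    Measurable[inputSigma X₀ d A] fun ω => X₀ ω k := by
  have h : Measurable[MeasurableSpace.comap X₀ inferInstance] X₀ := comap_measurable X₀
  exact (measurable_pi_apply k).comp (h.mono le_sup_left le_rfl)

theorem measurableSet_lt_queueWave_of {t i : ℕ}
    (hX : ∀ k, Measurable[inputSigma X₀ d (customerSteps (t + k))]
      fun ω => spatialQueue cp (X₀ ω) (d ω) t k) :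
    MeasurableSet[inputSigma X₀ d (customerSteps (t + i + 1))]
      {ω | (i : ℕ∞) < queueWave cp (X₀ ω) (d ω) t} := by
  let _ : MeasurableSpace Ω := inputSigma X₀ d (customerSteps (t + i + 1))
  simp only [queueWave, lt_waveLength_iff, Set.ofPred_forall]
  refine MeasurableSet.iInter fun m => MeasurableSet.iInter fun hm => measurableSet_lt ?_ ?_
  · refine Finset.measurable_sum _ fun l hl => measurable_step_inputSigma ?_
    rw [Finset.mem_range] at hl
    simp only [customerSteps, Set.mem_ofPred_eq]
    omega
  · exact ((hX (m + 2)).mono (inputSigma_mono (customerSteps_mono (by omega))) le_rfl).sub_const cp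

theorem measurable_spatialQueue_inputSigma (cp : ℝ) (X₀ : Ω → ℕ → ℝ) (d : Ω → ℕ → ℕ → ℝ)
    (t k : ℕ) : Measurable[inputSigma X₀ d (customerSteps (t + k))]
      fun ω => spatialQueue cp (X₀ ω) (d ω) t k := by
  induction t generalizing k with
  | zero => exact measurable_init_inputSigma _ k
  | succ t ih =>
    let _ : MeasurableSpace Ω := inputSigma X₀ d (customerSteps (t + 1 + k))
    refine Measurable.ite (p := fun ω => (k : ℕ∞) < queueWave cp (X₀ ω) (d ω) t) ?_ ?_ ?_
    · have := measurableSet_lt_queueWave_of (cp := cp) (i := k) ih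
      rwa [show t + k + 1 = t + 1 + k by ring] at this
    · refine Finset.measurable_sum _ fun l hl => measurable_step_inputSigma ?_
      rw [Finset.mem_range] at hl
      simp only [customerSteps, Set.mem_ofPred_eq]
      omega
    · have := ih (k + 1)
      rwa [show t + (k + 1) = t + 1 + k by ring] at this

theorem measurableSet_lt_queueWave_inputSigma (cp : ℝ) (X₀ : Ω → ℕ → ℝ) (d : Ω → ℕ → ℕ → ℝ)
    (t i : ℕ) : MeasurableSet[inputSigma X₀ d (customerSteps (t + i + 1))]
      {ω | (i : ℕ∞) < queueWave cp (X₀ ω) (d ω) t} :=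
  measurableSet_lt_queueWave_of (measurable_spatialQueue_inputSigma cp X₀ d t)

theorem measurable_displacement_inputSigma (cp : ℝ) (X₀ : Ω → ℕ → ℝ) (d : Ω → ℕ → ℕ → ℝ)
    (t i : ℕ) : Measurable[inputSigma X₀ d (customerSteps (t + i + 1))]
      fun ω => displacement cp (X₀ ω) (d ω) t i := by
  refine Measurable.sub (m := inputSigma X₀ d (customerSteps (t + i + 1)))
    (measurable_spatialQueue_inputSigma cp X₀ d t (i + 1)) ?_
  have := measurable_spatialQueue_inputSigma cp X₀ d (t + 1) i
  rwa [show t + 1 + i = t + i + 1 by ring] at this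

theorem measurable_moves_inputSigma (cp : ℝ) (X₀ : Ω → ℕ → ℝ) (d : Ω → ℕ → ℕ → ℝ)
    (t i : ℕ) : Measurable[inputSigma X₀ d (customerSteps (t + i + 1))]
      fun ω => moves cp (X₀ ω) (d ω) t i := by
  let _ : MeasurableSpace Ω := inputSigma X₀ d (customerSteps (t + i + 1))
  exact Measurable.ite (measurableSet_lt_queueWave_inputSigma cp X₀ d t i) measurable_const
    measurable_const

/-- `headStep` at time `t` only uses stopping distances of earlier steps. -/
theorem measurable_headStep_inputSigma (cp : ℝ) (X₀ : Ω → ℕ → ℝ) (d : Ω → ℕ → ℕ → ℝ)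
    (t k : ℕ) {A : Set (ℕ × ℕ)} (hA : customerSteps (t + k) ⊆ A)
    (hA' : ∀ s l, s < t → s + l + 1 = t + k → (s, l) ∈ A) :
    Measurable[inputSigma X₀ d A] fun ω => headStep cp (X₀ ω) (d ω) t k := by
  let _ : MeasurableSpace Ω := inputSigma X₀ d A
  induction t generalizing k with
  | zero => exact measurable_const
  | succ t ih =>
    refine Measurable.ite (p := fun ω => (k : ℕ∞) < queueWave cp (X₀ ω) (d ω) t) ?_ ?_ ?_
    · refine inputSigma_mono ?_ _ (measurableSet_lt_queueWave_inputSigma cp X₀ d t k)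
      rwa [show t + k + 1 = t + 1 + k by ring]
    · exact measurable_step_inputSigma (hA' t k (by omega) (by omega))
    · refine ih (k + 1) ?_ fun s l hs hl => hA' s l (by omega) (by omega)
      rwa [show t + (k + 1) = t + 1 + k by ring]

variable [mΩ : MeasurableSpace Ω] {P : Measure Ω}

theorem IsQueueInput.inputSigma_le (h : IsQueueInput P cm cp v X₀ d) (A : Set (ℕ × ℕ)) :
    inputSigma X₀ d A ≤ mΩ :=
  sup_le h.measurable_init.comap_le (iSup₂_le fun p _ => (h.measurable_step p.1 p.2).comap_le)

/-- A stopping distance is independent of the initial configuration together with any collection of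
other stopping distances. -/
theorem IsQueueInput.indep_step (h : IsQueueInput P cm cp v X₀ d) [IsProbabilityMeasure P]
    {A : Set (ℕ × ℕ)} {t i : ℕ} (hA : (t, i) ∉ A) :
    Indep (inputSigma X₀ d A) (MeasurableSpace.comap (fun ω => d ω t i) inferInstance) P := by
  set m : Option (ℕ × ℕ) → MeasurableSpace Ω := fun o => o.elim
    (MeasurableSpace.comap X₀ inferInstance)
    (fun p => MeasurableSpace.comap (fun ω => d ω p.1 p.2) inferInstance) with hm
  have hle : ∀ o, m o ≤ mΩ := by
    rintro (_ | p)
    · exact h.measurable_init.comap_le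
    · exact (h.measurable_step p.1 p.2).comap_le
  have hind : iIndep m P := by
    rw [iIndep_iff]
    intro s f hf
    have hsome : P (⋂ p ∈ s.eraseNone, f (some p)) = ∏ p ∈ s.eraseNone, P (f (some p)) :=
      (iIndep_iff _ _).mp h.iIndepFun_step _ (f := fun p => f (some p))
        fun p hp => hf (some p) (Finset.mem_eraseNone.mp hp)
    have hmeas : MeasurableSet[MeasurableSpace.comap (fun ω (p : ℕ × ℕ) => d ω p.1 p.2)
        inferInstance] (⋂ p ∈ s.eraseNone, f (some p)) := by
      refine Finset.measurableSet_biInter _ fun p hp => ?_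
      obtain ⟨S, hS, hSf⟩ := hf (some p) (Finset.mem_eraseNone.mp hp)
      exact ⟨(fun e : ℕ × ℕ → ℝ => e p) ⁻¹' S, measurable_pi_apply p hS, hSf⟩
    by_cases hn : none ∈ s
    · have hs : s = Finset.insertNone s.eraseNone := by
        rw [Finset.insertNone_eraseNone, Finset.insert_eq_of_mem hn]
      have h1 : (⋂ o ∈ s, f o) = f none ∩ ⋂ p ∈ s.eraseNone, f (some p) := by
        ext ω
        simp only [Set.mem_inter_iff, Set.mem_iInter₂]
        refine ⟨fun H => ⟨H none hn, fun p hp => H (some p) (Finset.mem_eraseNone.mp hp)⟩, ?_⟩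
        rintro ⟨H0, H1⟩ (_ | p) ho
        · exact H0
        · exact H1 p (Finset.mem_eraseNone.mpr ho)
      rw [h1, (Indep_iff _ _ _).mp h.indepFun_init _ _ (hf none hn) hmeas, hsome]
      conv_rhs => rw [hs]
      rw [Finset.prod_insertNone]
    · have hs : s = s.eraseNone.map Function.Embedding.some := by
        rw [Finset.map_some_eraseNone, Finset.erase_eq_of_notMem hn]
      have h1 : (⋂ o ∈ s, f o) = ⋂ p ∈ s.eraseNone, f (some p) := by
        ext ω
        simp only [Set.mem_iInter₂]
        refine ⟨fun H p hp => H (some p) (Finset.mem_eraseNone.mp hp), ?_⟩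
        rintro H (_ | p) ho
        · exact absurd ho hn
        · exact H p (Finset.mem_eraseNone.mpr ho)
      rw [h1, hsome]
      conv_rhs => rw [hs]
      rw [Finset.prod_map]
      rfl
  have hdisj : Disjoint (insert none (some '' A)) {some (t, i)} := by
    rw [Set.disjoint_singleton_right]
    simpa using hA
  have := indep_iSup_of_disjoint hle hind hdisj
  refine indep_of_indep_of_le_left (indep_of_indep_of_le_right this ?_) ?_
  · exact le_iSup₂_of_le (some (t, i)) rfl le_rfl
  · refine sup_le ?_ (iSup₂_le fun p hp => ?_)
    · exact le_iSup₂_of_le none (Set.mem_insert _ _) le_rfl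
    · exact le_iSup₂_of_le (some p) (Set.mem_insert_of_mem _ (Set.mem_image_of_mem _ hp)) le_rfl

theorem integrable_of_abs_le [IsFiniteMeasure P] {f : Ω → ℝ} (hf : Measurable f) {C : ℝ}
    (hC : ∀ ω, |f ω| ≤ C) : Integrable f P :=
  Integrable.of_bound hf.aestronglyMeasurable C (Eventually.of_forall hC)

theorem IsQueueInput.integral_mul_step (h : IsQueueInput P cm cp v X₀ d) [IsProbabilityMeasure P]
    {A : Set (ℕ × ℕ)} {t i : ℕ} (hA : (t, i) ∉ A) {ψ : Ω → ℝ}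
    (hψ : Measurable[inputSigma X₀ d A] ψ) {φ : ℝ → ℝ} (hφ : Measurable φ) :
    ∫ ω, ψ ω * φ (d ω t i) ∂P = (∫ ω, ψ ω ∂P) * ∫ ω, φ (d ω t i) ∂P := by
  have hind : IndepFun ψ (fun ω => φ (d ω t i)) P := by
    have h1 : IndepFun ψ (fun ω => d ω t i) P :=
      indep_of_indep_of_le_left (h.indep_step hA) hψ.comap_le
    exact h1.comp measurable_id hφ
  exact hind.integral_fun_mul_eq_mul_integral
    (hψ.mono (h.inputSigma_le A) le_rfl).aestronglyMeasurable
    (hφ.comp (h.measurable_step t i)).aestronglyMeasurable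

theorem IsQueueInput.integrable_step (h : IsQueueInput P cm cp v X₀ d) [IsProbabilityMeasure P]
    (t i : ℕ) : Integrable (fun ω => d ω t i) P :=
  Integrable.of_mem_Icc cm cp (h.measurable_step t i).aemeasurable
    (Eventually.of_forall fun ω => h.step_mem ω t i)

theorem IsQueueInput.integral_mul_step_sub_one (h : IsQueueInput P cm cp v X₀ d)
    [IsProbabilityMeasure P] {A : Set (ℕ × ℕ)} {t i : ℕ} (hA : (t, i) ∉ A) {ψ : Ω → ℝ}
    (hψ : Measurable[inputSigma X₀ d A] ψ) : ∫ ω, ψ ω * (d ω t i - 1) ∂P = 0 := by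
  rw [h.integral_mul_step hA hψ (φ := fun y => y - 1) (measurable_id.sub_const 1),
    integral_sub (h.integrable_step t i) (integrable_const 1), h.integral_step]
  simp

theorem IsQueueInput.one_mem (h : IsQueueInput P cm cp v X₀ d) [IsProbabilityMeasure P] :
    (1 : ℝ) ∈ Set.Icc cm cp := by
  have hi := h.integral_step 0 0
  have h1 : ∫ _, cm ∂P ≤ ∫ ω, d ω 0 0 ∂P :=
    integral_mono (integrable_const _) (h.integrable_step 0 0) fun ω => (h.step_mem ω 0 0).1
  have h2 : ∫ ω, d ω 0 0 ∂P ≤ ∫ _, cp ∂P :=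
    integral_mono (h.integrable_step 0 0) (integrable_const _) fun ω => (h.step_mem ω 0 0).2
  simp only [integral_const, probReal_univ, one_smul] at h1 h2
  exact ⟨by linarith, by linarith⟩

theorem IsQueueInput.measurable_headStep (h : IsQueueInput P cm cp v X₀ d) (t k : ℕ) :
    Measurable fun ω => headStep cp (X₀ ω) (d ω) t k :=
  (measurable_headStep_inputSigma cp X₀ d t k (Set.subset_univ _) fun _ _ _ _ =>
    Set.mem_univ _).mono (h.inputSigma_le _) le_rfl

theorem IsQueueInput.headStep_mem (h : IsQueueInput P cm cp v X₀ d) [IsProbabilityMeasure P]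
    (ω : Ω) (t k : ℕ) : headStep cp (X₀ ω) (d ω) t k ∈ Set.Icc cm cp :=
  headValue_mem (h.step_mem ω) h.one_mem t k

theorem IsQueueInput.abs_headStep_sub_one_le (h : IsQueueInput P cm cp v X₀ d) (hcm : 0 < cm)
    [IsProbabilityMeasure P] (ω : Ω) (t k : ℕ) : |headStep cp (X₀ ω) (d ω) t k - 1| ≤ cp := by
  have h1 := h.headStep_mem ω t k
  have h2 := h.one_mem
  rw [abs_le]
  exact ⟨by linarith [h1.1, h2.2], by linarith [h1.2, h2.1]⟩

theorem IsQueueInput.abs_step_sub_one_le (h : IsQueueInput P cm cp v X₀ d) (hcm : 0 < cm)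
    [IsProbabilityMeasure P] (ω : Ω) (t k : ℕ) : |d ω t k - 1| ≤ cp := by
  have h1 := h.step_mem ω t k
  have h2 := h.one_mem
  rw [abs_le]
  exact ⟨by linarith [h1.1, h2.2], by linarith [h1.2, h2.1]⟩

theorem abs_mul_le_of_le {a b C c : ℝ} (ha : |a| ≤ C) (hb : |b| ≤ c) : |a * b| ≤ C * c := by
  rw [abs_mul]
  exact mul_le_mul ha hb (abs_nonneg _) ((abs_nonneg _).trans ha)

/-- The next step of the walk of the customer `t + k` has mean `1` given the past. -/
theorem IsQueueInput.integral_mul_headStep_sub_one (h : IsQueueInput P cm cp v X₀ d)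
    (hcm : 0 < cm) [IsProbabilityMeasure P] (t k : ℕ) {ψ : Ω → ℝ}
    (hψ : Measurable[inputSigma X₀ d (customerSteps (t + k))] ψ) {C : ℝ}
    (hC : ∀ ω, |ψ ω| ≤ C) : ∫ ω, ψ ω * (headStep cp (X₀ ω) (d ω) t k - 1) ∂P = 0 := by
  induction t generalizing k ψ with
  | zero => simp [headStep, headValue]
  | succ t ih =>
    have e : customerSteps (t + k + 1) = customerSteps (t + 1 + k) := by
      rw [show t + k + 1 = t + 1 + k by ring]
    have hm : Measurable[inputSigma X₀ d (customerSteps (t + 1 + k))]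
        fun ω => moves cp (X₀ ω) (d ω) t k := e ▸ measurable_moves_inputSigma cp X₀ d t k
    have ha : Measurable[inputSigma X₀ d (customerSteps (t + 1 + k))]
        fun ω => ψ ω * moves cp (X₀ ω) (d ω) t k :=
      Measurable.mul (m := inputSigma X₀ d (customerSteps (t + 1 + k))) hψ hm
    have hb : Measurable[inputSigma X₀ d (customerSteps (t + 1 + k))]
        fun ω => ψ ω * (1 - moves cp (X₀ ω) (d ω) t k) :=
      Measurable.mul (m := inputSigma X₀ d (customerSteps (t + 1 + k))) hψ
        (Measurable.const_sub (m := inputSigma X₀ d (customerSteps (t + 1 + k))) hm 1)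
    have hm01 : ∀ ω, moves cp (X₀ ω) (d ω) t k ∈ Set.Icc (0 : ℝ) 1 := fun ω => moves_mem t k
    have haC : ∀ ω, |ψ ω * moves cp (X₀ ω) (d ω) t k| ≤ C := fun ω =>
      (abs_mul_le_of_le (hC ω) (abs_le.mpr
        ⟨by linarith [(hm01 ω).1], (hm01 ω).2⟩)).trans_eq (mul_one C)
    have hbC : ∀ ω, |ψ ω * (1 - moves cp (X₀ ω) (d ω) t k)| ≤ C := fun ω =>
      (abs_mul_le_of_le (hC ω) (abs_le.mpr
        ⟨by linarith [(hm01 ω).2], by linarith [(hm01 ω).1]⟩)).trans_eq (mul_one C)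
    have hle := h.inputSigma_le (customerSteps (t + 1 + k))
    have hsplit : (fun ω => ψ ω * (headStep cp (X₀ ω) (d ω) (t + 1) k - 1)) = fun ω =>
        ψ ω * moves cp (X₀ ω) (d ω) t k * (d ω t k - 1) +
          ψ ω * (1 - moves cp (X₀ ω) (d ω) t k) *
            (headStep cp (X₀ ω) (d ω) t (k + 1) - 1) := by
      funext ω
      simp only [headStep, headValue, moves]
      split_ifs <;> ring
    rw [hsplit, integral_add, h.integral_mul_step_sub_one _ ha, ih (k + 1) _ hbC, add_zero]
    · rwa [show t + (k + 1) = t + 1 + k by ring]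
    · simp only [customerSteps, Set.mem_ofPred_eq]; omega
    · exact integrable_of_abs_le ((ha.mono hle le_rfl).mul ((h.measurable_step t k).sub_const 1))
        fun ω => abs_mul_le_of_le (haC ω) (h.abs_step_sub_one_le hcm ω t k)
    · exact integrable_of_abs_le ((hb.mono hle le_rfl).mul
        ((h.measurable_headStep t (k + 1)).sub_const 1))
        fun ω => abs_mul_le_of_le (hbC ω) (h.abs_headStep_sub_one_le hcm ω t (k + 1))

/-- The next step of a wave is centred given all earlier waves and the customers in front, hence
orthogonal to the next step of the older walk that it follows. -/
theorem IsQueueInput.integral_mul_headStep_mul_step (h : IsQueueInput P cm cp v X₀ d)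
    [IsProbabilityMeasure P] (t i : ℕ) {ψ : Ω → ℝ}
    (hψ : Measurable[inputSigma X₀ d (customerSteps (t + i + 1))] ψ) :
    ∫ ω, ψ ω * (headStep cp (X₀ ω) (d ω) t (i + 1) - 1) * (d ω t i - 1) ∂P = 0 := by
  set A : Set (ℕ × ℕ) := customerSteps (t + i + 1) ∪ {p | p.1 < t}
  have hA : (t, i) ∉ A := by
    simp only [A, customerSteps, Set.mem_union, Set.mem_ofPred_eq]
    omega
  refine h.integral_mul_step_sub_one hA ?_
  have hη : Measurable[inputSigma X₀ d A] fun ω => headStep cp (X₀ ω) (d ω) t (i + 1) :=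
    measurable_headStep_inputSigma cp X₀ d t (i + 1) Set.subset_union_left
      fun s l hs _ => Or.inr hs
  let _ : MeasurableSpace Ω := inputSigma X₀ d A
  exact (hψ.mono (inputSigma_mono Set.subset_union_left) le_rfl).mul (hη.sub_const 1)

theorem step_notMem_customerSteps (t i : ℕ) : (t, i) ∉ customerSteps (t + i + 1) := by
  simp only [customerSteps, Set.mem_ofPred_eq]
  omega

theorem IsQueueInput.integral_mul_headStep_sub_step (h : IsQueueInput P cm cp v X₀ d)
    (hcm : 0 < cm) [IsProbabilityMeasure P] (t i : ℕ) {ψ : Ω → ℝ}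
    (hψ : Measurable[inputSigma X₀ d (customerSteps (t + i + 1))] ψ) {C : ℝ}
    (hC : ∀ ω, |ψ ω| ≤ C) :
    ∫ ω, ψ ω * (headStep cp (X₀ ω) (d ω) t (i + 1) - d ω t i) ∂P = 0 := by
  have hψm : Measurable ψ := hψ.mono (h.inputSigma_le _) le_rfl
  have hsplit : (fun ω => ψ ω * (headStep cp (X₀ ω) (d ω) t (i + 1) - d ω t i)) = fun ω =>
      ψ ω * (headStep cp (X₀ ω) (d ω) t (i + 1) - 1) - ψ ω * (d ω t i - 1) := by
    funext ω; ring
  rw [hsplit, integral_sub,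
    h.integral_mul_step_sub_one (step_notMem_customerSteps t i) hψ,
    h.integral_mul_headStep_sub_one hcm t (i + 1) hψ hC, sub_zero]
  · exact integrable_of_abs_le (hψm.mul ((h.measurable_headStep t (i + 1)).sub_const 1))
      fun ω => abs_mul_le_of_le (hC ω) (h.abs_headStep_sub_one_le hcm ω t (i + 1))
  · exact integrable_of_abs_le (hψm.mul ((h.measurable_step t i).sub_const 1))
      fun ω => abs_mul_le_of_le (hC ω) (h.abs_step_sub_one_le hcm ω t i)

/-- The increment of the distance between two neighbouring walks has conditional second moment at
least `v`. -/
theorem IsQueueInput.le_integral_mul_headStep_sub_step_sq (h : IsQueueInput P cm cp v X₀ d)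
    (hcm : 0 < cm) [IsProbabilityMeasure P] (t i : ℕ) {ψ : Ω → ℝ}
    (hψ : Measurable[inputSigma X₀ d (customerSteps (t + i + 1))] ψ) {C : ℝ}
    (hC : ∀ ω, |ψ ω| ≤ C) (h0 : ∀ ω, 0 ≤ ψ ω) :
    v * ∫ ω, ψ ω ∂P ≤ ∫ ω, ψ ω * (headStep cp (X₀ ω) (d ω) t (i + 1) - d ω t i) ^ 2 ∂P := by
  have hψm : Measurable ψ := hψ.mono (h.inputSigma_le _) le_rfl
  have hη := (h.measurable_headStep t (i + 1)).sub_const 1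
  have hξ := (h.measurable_step t i).sub_const 1
  have hsq : ∫ ω, ψ ω * (d ω t i - 1) ^ 2 ∂P = v * ∫ ω, ψ ω ∂P := by
    rw [h.integral_mul_step (step_notMem_customerSteps t i) hψ (φ := fun y => (y - 1) ^ 2)
      ((measurable_id.sub_const 1).pow_const 2), h.integral_sq, mul_comm]
  have hcross := h.integral_mul_headStep_mul_step (cp := cp) t i hψ
  have hi1 : Integrable (fun ω => ψ ω * (d ω t i - 1) ^ 2) P := by
    refine integrable_of_abs_le (hψm.mul (hξ.pow_const 2)) (C := C * (cp * cp)) fun ω => ?_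
    rw [pow_two]
    exact abs_mul_le_of_le (hC ω) (abs_mul_le_of_le (h.abs_step_sub_one_le hcm ω t i)
      (h.abs_step_sub_one_le hcm ω t i))
  have hi2 : Integrable (fun ω =>
      ψ ω * (headStep cp (X₀ ω) (d ω) t (i + 1) - 1) * (d ω t i - 1)) P :=
    integrable_of_abs_le ((hψm.mul hη).mul hξ) fun ω =>
      abs_mul_le_of_le (abs_mul_le_of_le (hC ω) (h.abs_headStep_sub_one_le hcm ω t (i + 1)))
        (h.abs_step_sub_one_le hcm ω t i)
  have hi3 : Integrable (fun ω =>
      ψ ω * (headStep cp (X₀ ω) (d ω) t (i + 1) - d ω t i) ^ 2) P := by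
    refine integrable_of_abs_le (hψm.mul (((h.measurable_headStep t (i + 1)).sub
      (h.measurable_step t i)).pow_const 2)) (C := C * ((cp + cp) * (cp + cp))) fun ω => ?_
    have hb : |headStep cp (X₀ ω) (d ω) t (i + 1) - d ω t i| ≤ cp + cp := by
      have h1 := abs_le.mp (h.abs_headStep_sub_one_le hcm ω t (i + 1))
      have h2 := abs_le.mp (h.abs_step_sub_one_le hcm ω t i)
      exact abs_le.mpr ⟨by linarith, by linarith⟩
    rw [pow_two]
    exact abs_mul_le_of_le (hC ω) (abs_mul_le_of_le hb hb)
  calc v * ∫ ω, ψ ω ∂P = ∫ ω, (ψ ω * (d ω t i - 1) ^ 2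
        - 2 * (ψ ω * (headStep cp (X₀ ω) (d ω) t (i + 1) - 1) * (d ω t i - 1))) ∂P := by
        rw [integral_sub hi1 (hi2.const_mul 2), integral_const_mul, hcross, hsq]; ring
    _ ≤ _ := by
        refine integral_mono (hi1.sub (hi2.const_mul 2)) hi3 fun ω => ?_
        have := mul_nonneg (h0 ω) (sq_nonneg (headStep cp (X₀ ω) (d ω) t (i + 1) - 1))
        simp only
        nlinarith

end Random

/-! ### Pathwise inequalities for sums over steps and ranks -/

section Pathwise

variable {cm cp : ℝ} {x : ℕ → ℝ} {d : ℕ → ℕ → ℝ}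

/-- Summing the near-submartingale property of `(L - displacement)⁺ ^ 2`: the quadratic terms are
controlled because each wave joins only once and each join perturbs at most one displacement. -/
theorem sum_sum_headStep_sub_step_sq_le (hcm : 0 < cm) (h1 : (1 : ℝ) ∈ Set.Icc cm cp)
    (hx : x ∈ queueConfigs cm cp) (hd : ∀ t i, d t i ∈ Set.Icc cm cp) {L : ℝ} (hL : cp ≤ L)
    {B : ℝ} {τ j : ℕ}
    (hB : ∑ t ∈ Finset.range τ, ∑ i ∈ Finset.range j, unmoved cp x d t (i + 1) ≤ B) :
    ∑ t ∈ Finset.range τ, ∑ i ∈ Finset.range j,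
        (moves cp x d t i * (if displacement cp x d t i ≤ L - cp then 1 else 0)
          * (headStep cp x d t (i + 1) - d t i) ^ 2
        - moves cp x d t i * (2 * max (L - displacement cp x d t i) 0)
          * (headStep cp x d t (i + 1) - d t i)) ≤ 10 * L * cp * τ + 4 * L * cp * B := by
  have hcp : 0 < cp := by linarith [h1.1, h1.2]
  have hLcp : 0 ≤ L * cp := mul_nonneg (hcp.le.trans hL) hcp.le
  have hw : ∀ N t, waveWeight cp x d (fun _ => 1) N t ≤ 1 := fun N t =>
    waveWeight_le N t zero_le_one fun _ _ _ => le_rfl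
  have hκ : ∑ t ∈ Finset.range τ, ∑ i ∈ Finset.range j,
      moves cp x d t i * headJoin cp x d (fun _ => 1) t (i + 1) ≤ τ := by
    refine (sum_headJoin_le (fun _ => zero_le_one) τ j).trans
      ((Finset.sum_le_sum fun t _ => hw _ t).trans ?_)
    simp
  have hend : ∑ t ∈ Finset.range τ, ∑ i ∈ Finset.range j,
      moves cp x d t i * waveEnd cp x d (fun _ => 1) t i ≤ τ := by
    refine (Finset.sum_le_sum fun t _ => hw j t).trans ?_
    simp
  have htel : ∑ t ∈ Finset.range τ, ∑ i ∈ Finset.range j,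
      ((max (L - displacement cp x d t (i + 1)) 0) ^ 2
        - (max (L - displacement cp x d t i) 0) ^ 2) ≤ 2 * L * cp * τ := by
    have : ∀ t ∈ Finset.range τ, ∑ i ∈ Finset.range j,
        ((max (L - displacement cp x d t (i + 1)) 0) ^ 2
          - (max (L - displacement cp x d t i) 0) ^ 2) ≤ 2 * L * cp := by
      intro t _
      rw [Finset.sum_range_sub (fun i => (max (L - displacement cp x d t i) 0) ^ 2)]
      have h2 := displacement_zero_le hcm hx hd t
      have h3 := displacement_nonneg hcm hx hd t j
      have h4 : (max (L - displacement cp x d t j) 0) ^ 2 ≤ L ^ 2 :=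
        pow_le_pow_left₀ (le_max_right _ _) (max_le (by linarith) (by linarith)) 2
      have h5 : (L - cp) ^ 2 ≤ (max (L - displacement cp x d t 0) 0) ^ 2 :=
        pow_le_pow_left₀ (by linarith) (le_max_of_le_left (by linarith)) 2
      nlinarith
    refine (Finset.sum_le_sum this).trans (le_of_eq ?_)
    simp; ring
  calc _ ≤ ∑ t ∈ Finset.range τ, ∑ i ∈ Finset.range j,
        (((max (L - displacement cp x d t (i + 1)) 0) ^ 2
            - (max (L - displacement cp x d t i) 0) ^ 2)
          + 4 * L * cp * (moves cp x d t i * waveEnd cp x d (fun _ => 1) t i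
            + moves cp x d t i * headJoin cp x d (fun _ => 1) t (i + 1)
            + unmoved cp x d t (i + 1))) :=
        Finset.sum_le_sum fun t _ => Finset.sum_le_sum fun i _ => by
          linarith [moves_mul_sq_posPart_le hcm h1 hx hd hL t i]
    _ ≤ 10 * L * cp * τ + 4 * L * cp * B := by
        simp only [Finset.sum_add_distrib, ← Finset.mul_sum]
        have := mul_le_mul_of_nonneg_left (add_le_add (add_le_add hend hκ) hB) hLcp
        linarith

theorem moves_le_of_cut (hcm : 0 < cm) (hx : x ∈ queueConfigs cm cp)
    (hd : ∀ t i, d t i ∈ Set.Icc cm cp) {l : ℝ} (hl : 0 < l) (t i : ℕ) :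
    moves cp x d t i ≤ moves cp x d t i * (if displacement cp x d t i ≤ l then 1 else 0)
      + displacement cp x d t i / l := by
  have h0 := displacement_nonneg hcm hx hd t i
  have hm := moves_mem (cp := cp) (x := x) (d := d) t i
  split_ifs with h
  · have : 0 ≤ displacement cp x d t i / l := by positivity
    linarith
  · have : 1 ≤ displacement cp x d t i / l := by
      rw [le_div_iff₀ hl]; linarith
    linarith [hm.2]

/-- Displacements have bounded mean, so they exceed `l` with frequency of order `1 / l`. -/
theorem sum_sum_moves_le (hcm : 0 < cm) (hcp : 0 < cp) (hx : x ∈ queueConfigs cm cp)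
    (hd : ∀ t i, d t i ∈ Set.Icc cm cp) {l : ℝ} (hl : 0 < l) (τ j : ℕ) :
    ∑ t ∈ Finset.range τ, ∑ i ∈ Finset.range j, moves cp x d t i ≤
      ∑ t ∈ Finset.range τ, ∑ i ∈ Finset.range j,
        moves cp x d t i * (if displacement cp x d t i ≤ l then 1 else 0)
      + j * ((cp * τ + cp * j) / l) := by
  have hD : ∑ t ∈ Finset.range τ, ∑ i ∈ Finset.range j, displacement cp x d t i / l ≤
      j * ((cp * τ + cp * j) / l) := by
    rw [Finset.sum_comm]
    have : ∀ i ∈ Finset.range j, ∑ t ∈ Finset.range τ, displacement cp x d t i / l ≤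
        (cp * τ + cp * j) / l := by
      intro i hi
      rw [← Finset.sum_div]
      have h1 := (sum_displacement_mem hcm hx hd i τ).2
      have h2 : (i : ℝ) ≤ j := by exact_mod_cast (Finset.mem_range.mp hi).le
      gcongr
      exact h1.trans (by gcongr)
    refine (Finset.sum_le_sum this).trans (le_of_eq ?_)
    simp
  calc _ ≤ ∑ t ∈ Finset.range τ, ∑ i ∈ Finset.range j,
        (moves cp x d t i * (if displacement cp x d t i ≤ l then 1 else 0)
          + displacement cp x d t i / l) :=
        Finset.sum_le_sum fun t _ => Finset.sum_le_sum fun i _ => moves_le_of_cut hcm hx hd hl t i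
    _ ≤ _ := by
        simp only [Finset.sum_add_distrib]
        linarith

/-- Long displacements contribute little: a pathwise inequality in which the only uncontrolled term
is a martingale transform. -/
theorem le_sum_moves_add (hcm : 0 < cm) (h1 : (1 : ℝ) ∈ Set.Icc cm cp)
    (hx : x ∈ queueConfigs cm cp) (hd : ∀ t i, d t i ∈ Set.Icc cm cp) {L : ℝ} (hL : 0 < L)
    {B : ℝ} {τ j : ℕ} (M : ℕ)
    (hB : ∑ t ∈ Finset.range τ, ∑ i ∈ Finset.range j, unmoved cp x d t (i + 1) ≤ B) :
    L * (cm * τ - cp * j) ≤ L ^ 2 * ∑ t ∈ Finset.range τ, moves cp x d t j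
      + (cp ^ 2 * τ
        + ∑ t ∈ Finset.range τ, ∑ i ∈ Finset.range j,
            moves cp x d t i * (2 * min (displacement cp x d t i) L)
              * (headStep cp x d t (i + 1) - d t i)
        + cp ^ 2 * ∑ t ∈ Finset.range τ, ∑ i ∈ Finset.range j, moves cp x d t i
        + 2 * cp * (cp * M * τ + L * ∑ t ∈ Finset.range τ, moves cp x d t M + L * B)) := by
  have hcp : 0 < cp := by linarith [h1.1, h1.2]
  set p : ℕ → ℝ := fun k => min (cp * k) L with hp
  have hp0 : ∀ k, 0 ≤ p k := fun k => le_min (by positivity) hL.le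
  -- waves no longer than `M` are cheap, longer ones are rare
  have hw : ∀ N t, waveWeight cp x d p N t ≤ cp * M + L * moves cp x d t M := by
    intro N t
    have hm := (moves_mem (cp := cp) (x := x) (d := d) t M).1
    refine waveWeight_le N t (by positivity) fun i hi hi1 => ?_
    by_cases hiM : i + 1 ≤ M
    · have h2 : ((i + 1 : ℕ) : ℝ) ≤ M := by exact_mod_cast hiM
      have h3 : p (i + 1) ≤ cp * M := (min_le_left _ _).trans (by gcongr)
      have h4 : 0 ≤ L * moves cp x d t M := by positivity
      linarith
    · have h2 : moves cp x d t M = 1 := if_pos (waveLength_lt_of_le hi (by omega))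
      have h3 : p (i + 1) ≤ L := min_le_right _ _
      have h4 : 0 ≤ cp * M := by positivity
      rw [h2]
      linarith
  have hκ : ∑ t ∈ Finset.range τ, ∑ i ∈ Finset.range j,
      moves cp x d t i * headJoin cp x d p t (i + 1) ≤
        cp * M * τ + L * ∑ t ∈ Finset.range τ, moves cp x d t M := by
    refine (sum_headJoin_le hp0 τ j).trans ((Finset.sum_le_sum fun t _ => hw _ t).trans ?_)
    rw [Finset.sum_add_distrib, Finset.sum_const, Finset.card_range, nsmul_eq_mul,
      ← Finset.mul_sum, mul_comm (τ : ℝ)]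
  have hD0 : ∑ t ∈ Finset.range τ, huber L (displacement cp x d t 0) ≤ cp ^ 2 * τ := by
    have : ∀ t ∈ Finset.range τ, huber L (displacement cp x d t 0) ≤ cp ^ 2 := by
      intro t _
      have h2 := displacement_zero_le hcm hx hd t
      have h3 := displacement_nonneg hcm hx hd t 0
      have h4 : displacement cp x d t 0 ^ 2 ≤ cp ^ 2 := pow_le_pow_left₀ h3 h2 2
      rw [huber]
      linarith [sq_nonneg (max (displacement cp x d t 0 - L) 0)]
    refine (Finset.sum_le_sum this).trans (le_of_eq ?_)
    simp [mul_comm]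
  have hDj : ∑ t ∈ Finset.range τ, huber L (displacement cp x d t j) ≤
      ∑ t ∈ Finset.range τ, huber L (displacement cp x d t 0)
        + (∑ t ∈ Finset.range τ, ∑ i ∈ Finset.range j,
            moves cp x d t i * (2 * min (displacement cp x d t i) L)
              * (headStep cp x d t (i + 1) - d t i)
        + cp ^ 2 * ∑ t ∈ Finset.range τ, ∑ i ∈ Finset.range j, moves cp x d t i
        + 2 * cp * (cp * M * τ + L * ∑ t ∈ Finset.range τ, moves cp x d t M + L * B)) := by
    have htel : ∑ t ∈ Finset.range τ, huber L (displacement cp x d t j) =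
        ∑ t ∈ Finset.range τ, huber L (displacement cp x d t 0) +
          ∑ t ∈ Finset.range τ, ∑ i ∈ Finset.range j,
            (huber L (displacement cp x d t (i + 1)) - huber L (displacement cp x d t i)) := by
      rw [← Finset.sum_add_distrib]
      refine Finset.sum_congr rfl fun t _ => ?_
      rw [Finset.sum_range_sub (fun i => huber L (displacement cp x d t i))]
      ring
    have hstep : ∑ t ∈ Finset.range τ, ∑ i ∈ Finset.range j,
        (huber L (displacement cp x d t (i + 1)) - huber L (displacement cp x d t i)) ≤
        ∑ t ∈ Finset.range τ, ∑ i ∈ Finset.range j,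
          (moves cp x d t i * (2 * min (displacement cp x d t i) L)
              * (headStep cp x d t (i + 1) - d t i)
            + cp ^ 2 * moves cp x d t i
            + 2 * cp * (moves cp x d t i * headJoin cp x d p t (i + 1)
              + L * unmoved cp x d t (i + 1))) :=
      Finset.sum_le_sum fun t _ => Finset.sum_le_sum fun i _ => by
        linarith [huber_displacement_succ_le hcm h1 hx hd hL.le t i]
    simp only [Finset.sum_add_distrib, ← Finset.mul_sum] at hstep
    have h5 : 2 * cp * (∑ t ∈ Finset.range τ, ∑ i ∈ Finset.range j,
        moves cp x d t i * headJoin cp x d p t (i + 1)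
          + L * ∑ t ∈ Finset.range τ, ∑ i ∈ Finset.range j, unmoved cp x d t (i + 1)) ≤
        2 * cp * (cp * M * τ + L * ∑ t ∈ Finset.range τ, moves cp x d t M + L * B) := by
      gcongr
    linarith
  have hcut : ∀ t ∈ Finset.range τ, L * displacement cp x d t j ≤
      L ^ 2 * moves cp x d t j + huber L (displacement cp x d t j) := by
    intro t _
    have hm := (moves_mem (cp := cp) (x := x) (d := d) t j).1
    rcases le_total L (displacement cp x d t j) with h | h
    · have := le_huber_of_le hL.le h
      have : 0 ≤ L ^ 2 * moves cp x d t j := by positivity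
      linarith
    · have h2 := huber_nonneg hL.le (displacement cp x d t j)
      have h3 := mul_le_mul_of_nonneg_left h (mul_nonneg hL.le hm)
      rw [mul_assoc, moves_mul_displacement] at h3
      linarith
  have hsum := Finset.sum_le_sum hcut
  rw [Finset.sum_add_distrib, ← Finset.mul_sum, ← Finset.mul_sum] at hsum
  have hlow := mul_le_mul_of_nonneg_left (sum_displacement_mem hcm hx hd j τ).1 hL.le
  linarith

end Pathwise

/-! ### Upper bound on the number of long waves -/

section Rates

variable {Ω : Type*} [mΩ : MeasurableSpace Ω] {P : Measure Ω}
  {X₀ : Ω → ℕ → ℝ} {d : Ω → ℕ → ℕ → ℝ} {cm cp v : ℝ}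

theorem IsQueueInput.measurable_moves (h : IsQueueInput P cm cp v X₀ d) (t i : ℕ) :
    Measurable fun ω => moves cp (X₀ ω) (d ω) t i :=
  (measurable_moves_inputSigma cp X₀ d t i).mono (h.inputSigma_le _) le_rfl

theorem abs_moves_le {x : ℕ → ℝ} {e : ℕ → ℕ → ℝ} (t i : ℕ) : |moves cp x e t i| ≤ 1 :=
  abs_le.mpr ⟨by linarith [(moves_mem (cp := cp) (x := x) (d := e) t i).1], (moves_mem t i).2⟩

theorem IsQueueInput.integral_moves (h : IsQueueInput P cm cp v X₀ d) (t i : ℕ) :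
    ∫ ω, moves cp (X₀ ω) (d ω) t i ∂P =
      P.real {ω | (i : ℕ∞) < queueWave cp (X₀ ω) (d ω) t} := by
  have hs : MeasurableSet {ω | (i : ℕ∞) < queueWave cp (X₀ ω) (d ω) t} :=
    h.inputSigma_le _ _ (measurableSet_lt_queueWave_inputSigma cp X₀ d t i)
  rw [← integral_indicator_one hs]
  refine integral_congr_ae (Eventually.of_forall fun ω => ?_)
  simp [moves, Set.indicator_apply]

variable [IsProbabilityMeasure P]

theorem IsQueueInput.integrable_moves (h : IsQueueInput P cm cp v X₀ d) (t i : ℕ) :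
    Integrable (fun ω => moves cp (X₀ ω) (d ω) t i) P :=
  integrable_of_abs_le (h.measurable_moves t i) fun _ => abs_moves_le t i

theorem IsQueueInput.abs_headStep_sub_step_le (h : IsQueueInput P cm cp v X₀ d) (hcm : 0 < cm)
    (ω : Ω) (t i : ℕ) : |headStep cp (X₀ ω) (d ω) t (i + 1) - d ω t i| ≤ cp := by
  have h1 := h.headStep_mem ω t (i + 1)
  have h2 := h.step_mem ω t i
  rw [abs_le]
  exact ⟨by linarith [h1.1, h2.2], by linarith [h1.2, h2.1]⟩

/-- Key upper bound: among the first `j` ranks and `τ` steps, about `τ * √j` moves are expected. -/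
theorem IsQueueInput.sum_sum_integral_moves_le (h : IsQueueInput P cm cp v X₀ d) (hcm : 0 < cm)
    (hv : 0 < v) {j : ℕ} (hj : 1 ≤ j) :
    ∃ B : ℝ, ∀ τ : ℕ, ∑ t ∈ Finset.range τ, ∑ i ∈ Finset.range j,
      ∫ ω, moves cp (X₀ ω) (d ω) t i ∂P ≤ (20 * cp ^ 2 / v + 1) * √j * τ + B := by
  have h1 := h.one_mem
  have hcp : 0 < cp := by linarith [h1.1, h1.2]
  obtain ⟨B, hB0, hB⟩ := exists_sum_unmoved_le hcm cp j
  have hj1 : (1 : ℝ) ≤ √j := by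
    rw [Real.one_le_sqrt]; exact_mod_cast hj
  have hjj : √(j : ℝ) * √j = j := Real.mul_self_sqrt (by positivity)
  set L : ℝ := 2 * cp * √j with hLdef
  have hLl : cp * √j ≤ L - cp := by nlinarith
  have hL : cp ≤ L := by nlinarith
  have hl : 0 < L - cp := lt_of_lt_of_le (by positivity) hLl
  refine ⟨4 * L * cp * B / v + j * (cp * j / (L - cp)), fun τ => ?_⟩
  set ψ : ℕ → ℕ → Ω → ℝ := fun t i ω =>
    moves cp (X₀ ω) (d ω) t i * (if displacement cp (X₀ ω) (d ω) t i ≤ L - cp then 1 else 0)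
  set χ : ℕ → ℕ → Ω → ℝ := fun t i ω =>
    moves cp (X₀ ω) (d ω) t i * (2 * max (L - displacement cp (X₀ ω) (d ω) t i) 0)
  have hψ : ∀ t i, Measurable[inputSigma X₀ d (customerSteps (t + i + 1))] (ψ t i) := by
    intro t i
    let _ : MeasurableSpace Ω := inputSigma X₀ d (customerSteps (t + i + 1))
    refine (measurable_moves_inputSigma cp X₀ d t i).mul (Measurable.ite ?_ measurable_const
      measurable_const)
    exact measurableSet_le (measurable_displacement_inputSigma cp X₀ d t i) measurable_const
  have hχ : ∀ t i, Measurable[inputSigma X₀ d (customerSteps (t + i + 1))] (χ t i) := by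
    intro t i
    let _ : MeasurableSpace Ω := inputSigma X₀ d (customerSteps (t + i + 1))
    exact (measurable_moves_inputSigma cp X₀ d t i).mul
      ((((measurable_displacement_inputSigma cp X₀ d t i).const_sub L).max
        measurable_const).const_mul 2)
  have hψ0 : ∀ t i ω, 0 ≤ ψ t i ω := fun t i ω =>
    mul_nonneg (moves_mem t i).1 (by split_ifs <;> simp)
  have hψ1 : ∀ t i ω, |ψ t i ω| ≤ 1 * 1 := fun t i ω =>
    abs_mul_le_of_le (abs_moves_le t i) (by split_ifs <;> simp)
  have hχL : ∀ t i ω, |χ t i ω| ≤ 1 * (2 * L) := by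
    intro t i ω
    refine abs_mul_le_of_le (abs_moves_le t i) ?_
    have hD := displacement_nonneg hcm (h.init_mem ω) (h.step_mem ω) t i
    rw [abs_of_nonneg (by positivity)]
    exact mul_le_mul_of_nonneg_left (max_le (by linarith) (by linarith)) zero_le_two
  have hψm : ∀ t i, Measurable (ψ t i) := fun t i => (hψ t i).mono (h.inputSigma_le _) le_rfl
  have hχm : ∀ t i, Measurable (χ t i) := fun t i => (hχ t i).mono (h.inputSigma_le _) le_rfl
  have hζ : ∀ t i, Measurable fun ω => headStep cp (X₀ ω) (d ω) t (i + 1) - d ω t i :=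
    fun t i => (h.measurable_headStep t (i + 1)).sub (h.measurable_step t i)
  have hψi : ∀ t i, Integrable (ψ t i) P := fun t i => integrable_of_abs_le (hψm t i) (hψ1 t i)
  have hi1 : ∀ t i, Integrable
      (fun ω => ψ t i ω * (headStep cp (X₀ ω) (d ω) t (i + 1) - d ω t i) ^ 2) P := by
    intro t i
    refine integrable_of_abs_le ((hψm t i).mul ((hζ t i).pow_const 2))
      (C := 1 * 1 * (cp * cp)) fun ω => ?_
    rw [pow_two]
    exact abs_mul_le_of_le (hψ1 t i ω) (abs_mul_le_of_le (h.abs_headStep_sub_step_le hcm ω t i)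
      (h.abs_headStep_sub_step_le hcm ω t i))
  have hi2 : ∀ t i, Integrable
      (fun ω => χ t i ω * (headStep cp (X₀ ω) (d ω) t (i + 1) - d ω t i)) P := fun t i =>
    integrable_of_abs_le ((hχm t i).mul (hζ t i)) fun ω =>
      abs_mul_le_of_le (hχL t i ω) (h.abs_headStep_sub_step_le hcm ω t i)
  have hi12 : ∀ t i, Integrable (fun ω =>
      ψ t i ω * (headStep cp (X₀ ω) (d ω) t (i + 1) - d ω t i) ^ 2
        - χ t i ω * (headStep cp (X₀ ω) (d ω) t (i + 1) - d ω t i)) P :=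
    fun t i => (hi1 t i).sub (hi2 t i)
  -- the variance of the increments forces the number of close pairs to be small
  have hclose : v * ∑ t ∈ Finset.range τ, ∑ i ∈ Finset.range j, ∫ ω, ψ t i ω ∂P ≤
      10 * L * cp * τ + 4 * L * cp * B := by
    calc v * ∑ t ∈ Finset.range τ, ∑ i ∈ Finset.range j, ∫ ω, ψ t i ω ∂P
        ≤ ∑ t ∈ Finset.range τ, ∑ i ∈ Finset.range j,
          ∫ ω, (ψ t i ω * (headStep cp (X₀ ω) (d ω) t (i + 1) - d ω t i) ^ 2
            - χ t i ω * (headStep cp (X₀ ω) (d ω) t (i + 1) - d ω t i)) ∂P := by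
          rw [Finset.mul_sum]
          refine Finset.sum_le_sum fun t _ => ?_
          rw [Finset.mul_sum]
          refine Finset.sum_le_sum fun i _ => ?_
          rw [integral_sub (hi1 t i) (hi2 t i),
            h.integral_mul_headStep_sub_step hcm t i (hχ t i) (hχL t i), sub_zero]
          exact h.le_integral_mul_headStep_sub_step_sq hcm t i (hψ t i) (hψ1 t i) (hψ0 t i)
      _ = ∫ ω, ∑ t ∈ Finset.range τ, ∑ i ∈ Finset.range j,
          (ψ t i ω * (headStep cp (X₀ ω) (d ω) t (i + 1) - d ω t i) ^ 2
            - χ t i ω * (headStep cp (X₀ ω) (d ω) t (i + 1) - d ω t i)) ∂P := by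
          rw [integral_finsetSum _ fun t _ => integrable_finsetSum _ fun i _ =>
            hi12 t i]
          refine Finset.sum_congr rfl fun t _ => ?_
          rw [integral_finsetSum _ fun i _ => hi12 t i]
      _ ≤ ∫ _, (10 * L * cp * τ + 4 * L * cp * B) ∂P := by
          refine integral_mono (integrable_finsetSum _ fun t _ => integrable_finsetSum _ fun i _ =>
            hi12 t i) (integrable_const _) fun ω => ?_
          exact sum_sum_headStep_sub_step_sq_le hcm h1 (h.init_mem ω) (h.step_mem ω) hL
            (hB _ (h.init_mem ω) _ (h.step_mem ω) τ)
      _ = _ := by simp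
  have hcut : ∑ t ∈ Finset.range τ, ∑ i ∈ Finset.range j, ∫ ω, moves cp (X₀ ω) (d ω) t i ∂P ≤
      ∑ t ∈ Finset.range τ, ∑ i ∈ Finset.range j, ∫ ω, ψ t i ω ∂P
        + j * ((cp * τ + cp * j) / (L - cp)) := by
    calc _ = ∫ ω, ∑ t ∈ Finset.range τ, ∑ i ∈ Finset.range j, moves cp (X₀ ω) (d ω) t i ∂P := by
          rw [integral_finsetSum _ fun t _ => integrable_finsetSum _ fun i _ =>
            h.integrable_moves t i]
          refine Finset.sum_congr rfl fun t _ => ?_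
          rw [integral_finsetSum _ fun i _ => h.integrable_moves t i]
      _ ≤ ∫ ω, (∑ t ∈ Finset.range τ, ∑ i ∈ Finset.range j, ψ t i ω
          + j * ((cp * τ + cp * j) / (L - cp))) ∂P :=
          integral_mono (integrable_finsetSum _ fun t _ => integrable_finsetSum _ fun i _ =>
            h.integrable_moves t i) ((integrable_finsetSum _ fun t _ => integrable_finsetSum _
              fun i _ => hψi t i).add (integrable_const _)) fun ω =>
            sum_sum_moves_le hcm hcp (h.init_mem ω) (h.step_mem ω) hl τ j
      _ = _ := by
          rw [integral_add (integrable_finsetSum _ fun t _ => integrable_finsetSum _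
              fun i _ => hψi t i) (integrable_const _),
            integral_finsetSum _ fun t _ => integrable_finsetSum _ fun i _ => hψi t i]
          congr 1
          · refine Finset.sum_congr rfl fun t _ => ?_
            rw [integral_finsetSum _ fun i _ => hψi t i]
          · simp
  have hclose' : ∑ t ∈ Finset.range τ, ∑ i ∈ Finset.range j, ∫ ω, ψ t i ω ∂P ≤
      20 * cp ^ 2 / v * √j * τ + 4 * L * cp * B / v := by
    rw [mul_comm, ← le_div_iff₀ hv] at hclose
    refine hclose.trans (le_of_eq ?_)
    rw [hLdef]; field_simp; ring
  have hfar : (j : ℝ) * ((cp * τ + cp * j) / (L - cp)) ≤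
      √j * τ + j * (cp * j / (L - cp)) := by
    rw [add_div, mul_add]
    refine add_le_add_left ?_ _
    have : (j : ℝ) * (cp * τ / (L - cp)) ≤ j * (cp * τ / (cp * √j)) := by gcongr
    refine this.trans (le_of_eq ?_)
    rw [mul_div_mul_left _ _ hcp.ne', ← mul_div_assoc, div_eq_iff (by positivity)]
    linear_combination (-(τ : ℝ)) * hjj
  linarith

theorem IsQueueInput.integral_moves_anti (h : IsQueueInput P cm cp v X₀ d) (t : ℕ) {i j : ℕ}
    (hij : i ≤ j) : ∫ ω, moves cp (X₀ ω) (d ω) t j ∂P ≤ ∫ ω, moves cp (X₀ ω) (d ω) t i ∂P := by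
  refine integral_mono (h.integrable_moves t j) (h.integrable_moves t i) fun ω => ?_
  simp only [moves]
  split_ifs with h1 h2
  · exact le_rfl
  · exact absurd (waveLength_lt_of_le h1 hij) h2
  · exact zero_le_one
  · exact le_rfl

/-- Upper bound on the expected number of waves longer than `j`. -/
theorem IsQueueInput.sum_integral_moves_le (h : IsQueueInput P cm cp v X₀ d) (hcm : 0 < cm)
    (hv : 0 < v) {j : ℕ} (hj : 1 ≤ j) :
    ∃ B : ℝ, ∀ τ : ℕ, ∑ t ∈ Finset.range τ, ∫ ω, moves cp (X₀ ω) (d ω) t j ∂P ≤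
      (20 * cp ^ 2 / v + 1) / √j * τ + B := by
  obtain ⟨B, hB⟩ := h.sum_sum_integral_moves_le hcm hv hj
  have hj0 : (0 : ℝ) < j := by exact_mod_cast hj
  have hjj : √(j : ℝ) * √j = j := Real.mul_self_sqrt hj0.le
  refine ⟨B / j, fun τ => ?_⟩
  have h1 : (∑ t ∈ Finset.range τ, ∫ ω, moves cp (X₀ ω) (d ω) t j ∂P) * j ≤
      ∑ t ∈ Finset.range τ, ∑ i ∈ Finset.range j, ∫ ω, moves cp (X₀ ω) (d ω) t i ∂P := by
    rw [Finset.sum_mul]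
    refine Finset.sum_le_sum fun t _ => ?_
    have := Finset.sum_le_sum fun i (hi : i ∈ Finset.range j) =>
      h.integral_moves_anti t (Finset.mem_range.mp hi).le
    simp only [Finset.sum_const, Finset.card_range, nsmul_eq_mul] at this
    linarith
  have h2 := h1.trans (hB τ)
  rw [← le_div_iff₀ hj0] at h2
  refine h2.trans (le_of_eq ?_)
  rw [add_div]
  congr 1
  have hs : √(j : ℝ) ≠ 0 := (Real.sqrt_pos.mpr hj0).ne'
  rw [div_mul_eq_mul_div, div_eq_div_iff hj0.ne' hs]
  linear_combination (20 * cp ^ 2 / v + 1) * τ * hjj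

/-! ### Lower bound on the number of long waves -/

theorem integral_add_add_add_add_const {f₁ f₂ f₃ f₄ : Ω → ℝ} (h₁ : Integrable f₁ P)
    (h₂ : Integrable f₂ P) (h₃ : Integrable f₃ P) (h₄ : Integrable f₄ P) (c : ℝ) :
    ∫ ω, (f₁ ω + f₂ ω + f₃ ω + f₄ ω + c) ∂P =
      ∫ ω, f₁ ω ∂P + ∫ ω, f₂ ω ∂P + ∫ ω, f₃ ω ∂P + ∫ ω, f₄ ω ∂P + c := by
  have h₁₂ : Integrable (fun ω => f₁ ω + f₂ ω) P := h₁.add h₂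
  have h₁₃ : Integrable (fun ω => f₁ ω + f₂ ω + f₃ ω) P := h₁₂.add h₃
  have h₁₄ : Integrable (fun ω => f₁ ω + f₂ ω + f₃ ω + f₄ ω) P := h₁₃.add h₄
  rw [integral_add h₁₄ (integrable_const c), integral_add h₁₃ h₄, integral_add h₁₂ h₃,
    integral_add h₁ h₂]
  simp

/-- Lower bound on the expected number of waves longer than `j`. The total displacement at rank `j`
grows at least like `cm * τ`, and displacements above `K * √j` contribute at most half of this. -/
theorem exists_le_sum_integral_moves (hcm : 0 < cm) (hcp : 0 < cp) (hv : 0 < v) :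
    ∃ K : ℝ, 0 < K ∧ ∀ (Ω : Type*) [MeasurableSpace Ω] (P : Measure Ω) [IsProbabilityMeasure P]
      (X₀ : Ω → ℕ → ℝ) (d : Ω → ℕ → ℕ → ℝ), IsQueueInput P cm cp v X₀ d →
      ∀ j : ℕ, 1 ≤ j → ∃ B : ℝ, ∀ τ : ℕ, cm / (2 * K) / √j * τ - B ≤
        ∑ t ∈ Finset.range τ, ∫ ω, moves cp (X₀ ω) (d ω) t j ∂P := by
  set C : ℝ := 20 * cp ^ 2 / v + 1 with hC
  have hC0 : 0 < C := by positivity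
  obtain ⟨M, hM⟩ := exists_nat_gt ((8 * cp * C / cm) ^ 2)
  have hM1 : 1 ≤ M := by
    have : (0 : ℝ) < M := lt_of_le_of_lt (sq_nonneg _) hM
    exact_mod_cast this
  have hMC : 2 * cp * (C / √M) ≤ cm / 4 := by
    have h1 : 8 * cp * C / cm ≤ √M := Real.le_sqrt_of_sq_le hM.le
    have h2 : 0 < √(M : ℝ) := Real.sqrt_pos.mpr (by exact_mod_cast hM1)
    rw [div_le_iff₀ hcm] at h1
    rw [← mul_div_assoc, div_le_iff₀ h2]
    linarith
  set K : ℝ := 4 / cm * (cp ^ 2 * (1 + C) + 2 * cp ^ 2 * M) with hK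
  have hK0 : 0 < K := by positivity
  refine ⟨K, hK0, fun Ω _ P _ X₀ d h j hj => ?_⟩
  have h1 := h.one_mem
  obtain ⟨B, hB0, hB⟩ := exists_sum_unmoved_le hcm cp j
  obtain ⟨B₁, hB₁⟩ := h.sum_sum_integral_moves_le hcm hv hj
  obtain ⟨B₂, hB₂⟩ := h.sum_integral_moves_le hcm hv hM1
  have hj1 : (1 : ℝ) ≤ √j := by
    rw [Real.one_le_sqrt]; exact_mod_cast hj
  set L : ℝ := K * √j with hLdef
  have hL : 0 < L := by positivity
  refine ⟨(L * cp * j + cp ^ 2 * B₁ + 2 * cp * (L * B₂ + L * B)) / L ^ 2, fun τ => ?_⟩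
  set χ : ℕ → ℕ → Ω → ℝ := fun t i ω =>
    moves cp (X₀ ω) (d ω) t i * (2 * min (displacement cp (X₀ ω) (d ω) t i) L)
  have hχ : ∀ t i, Measurable[inputSigma X₀ d (customerSteps (t + i + 1))] (χ t i) := by
    intro t i
    let _ : MeasurableSpace Ω := inputSigma X₀ d (customerSteps (t + i + 1))
    exact (measurable_moves_inputSigma cp X₀ d t i).mul
      (((measurable_displacement_inputSigma cp X₀ d t i).min measurable_const).const_mul 2)
  have hχL : ∀ t i ω, |χ t i ω| ≤ 1 * (2 * L) := by
    intro t i ω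
    refine abs_mul_le_of_le (abs_moves_le t i) ?_
    have hD := displacement_nonneg hcm (h.init_mem ω) (h.step_mem ω) t i
    rw [abs_of_nonneg (mul_nonneg zero_le_two (le_min hD hL.le))]
    exact mul_le_mul_of_nonneg_left (min_le_right _ _) zero_le_two
  have hi2 : ∀ t i, Integrable
      (fun ω => χ t i ω * (headStep cp (X₀ ω) (d ω) t (i + 1) - d ω t i)) P := fun t i =>
    integrable_of_abs_le (((hχ t i).mono (h.inputSigma_le _) le_rfl).mul
      ((h.measurable_headStep t (i + 1)).sub (h.measurable_step t i))) fun ω =>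
      abs_mul_le_of_le (hχL t i ω) (h.abs_headStep_sub_step_le hcm ω t i)
  have iS : ∀ k, Integrable (fun ω => ∑ t ∈ Finset.range τ, moves cp (X₀ ω) (d ω) t k) P :=
    fun k => integrable_finsetSum _ fun t _ => h.integrable_moves t k
  have iSS : Integrable (fun ω => ∑ t ∈ Finset.range τ, ∑ i ∈ Finset.range j,
      moves cp (X₀ ω) (d ω) t i) P :=
    integrable_finsetSum _ fun t _ => integrable_finsetSum _ fun i _ => h.integrable_moves t i
  have iχ : Integrable (fun ω => ∑ t ∈ Finset.range τ, ∑ i ∈ Finset.range j,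
      χ t i ω * (headStep cp (X₀ ω) (d ω) t (i + 1) - d ω t i)) P :=
    integrable_finsetSum _ fun t _ => integrable_finsetSum _ fun i _ => hi2 t i
  have eS : ∀ k, ∫ ω, ∑ t ∈ Finset.range τ, moves cp (X₀ ω) (d ω) t k ∂P =
      ∑ t ∈ Finset.range τ, ∫ ω, moves cp (X₀ ω) (d ω) t k ∂P :=
    fun k => integral_finsetSum _ fun t _ => h.integrable_moves t k
  have eSS : ∫ ω, ∑ t ∈ Finset.range τ, ∑ i ∈ Finset.range j, moves cp (X₀ ω) (d ω) t i ∂P =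
      ∑ t ∈ Finset.range τ, ∑ i ∈ Finset.range j, ∫ ω, moves cp (X₀ ω) (d ω) t i ∂P := by
    rw [integral_finsetSum _ fun t _ => integrable_finsetSum _ fun i _ => h.integrable_moves t i]
    exact Finset.sum_congr rfl fun t _ => integral_finsetSum _ fun i _ => h.integrable_moves t i
  have eχ : ∫ ω, ∑ t ∈ Finset.range τ, ∑ i ∈ Finset.range j,
      χ t i ω * (headStep cp (X₀ ω) (d ω) t (i + 1) - d ω t i) ∂P = 0 := by
    rw [integral_finsetSum _ fun t _ => integrable_finsetSum _ fun i _ => hi2 t i]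
    refine Finset.sum_eq_zero fun t _ => ?_
    rw [integral_finsetSum _ fun i _ => hi2 t i]
    exact Finset.sum_eq_zero fun i _ =>
      h.integral_mul_headStep_sub_step hcm t i (hχ t i) (hχL t i)
  have hint : L * (cm * τ - cp * j) ≤
      L ^ 2 * ∑ t ∈ Finset.range τ, ∫ ω, moves cp (X₀ ω) (d ω) t j ∂P
      + (cp ^ 2 * τ + 0
        + cp ^ 2 * ∑ t ∈ Finset.range τ, ∑ i ∈ Finset.range j,
            ∫ ω, moves cp (X₀ ω) (d ω) t i ∂P
        + 2 * cp * (cp * M * τ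
          + L * ∑ t ∈ Finset.range τ, ∫ ω, moves cp (X₀ ω) (d ω) t M ∂P + L * B)) := by
    set c : ℝ := cp ^ 2 * τ + 2 * cp * (cp * M * τ + L * B) with hc
    have e := integral_add_add_add_add_const ((iS j).const_mul (L ^ 2)) iχ
      (iSS.const_mul (cp ^ 2)) ((iS M).const_mul (2 * cp * L)) c
    have i5 := ((((iS j).const_mul (L ^ 2)).add iχ).add (iSS.const_mul (cp ^ 2))).add
      ((iS M).const_mul (2 * cp * L)) |>.add (integrable_const c)
    have hmono := integral_mono (integrable_const (μ := P) (L * (cm * τ - cp * j))) i5 fun ω => by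
      refine (le_sum_moves_add hcm h1 (h.init_mem ω) (h.step_mem ω) hL M
        (hB _ (h.init_mem ω) _ (h.step_mem ω) τ)).trans (le_of_eq ?_)
      simp only [Pi.add_apply, χ, hc]
      ring
    refine le_trans (le_of_eq (by simp)) (hmono.trans (e.le.trans (le_of_eq ?_)))
    rw [integral_const_mul, integral_const_mul, integral_const_mul, eS, eS, eSS, eχ, hc]
    ring
  have hSS := mul_le_mul_of_nonneg_left (hB₁ τ) (sq_nonneg cp)
  have hSM := mul_le_mul_of_nonneg_left (hB₂ τ) (mul_nonneg (mul_nonneg zero_le_two hcp.le) hL.le)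
  have hMτ : L * τ * (2 * cp * (C / √M)) ≤ L * τ * (cm / 4) := by gcongr
  -- the constant `K` absorbs all terms of order `√j`
  have hKτ : (cp ^ 2 + cp ^ 2 * C * √j + 2 * cp ^ 2 * M) * τ ≤ L * (cm / 4) * τ := by
    have e : L * (cm / 4) = (cp ^ 2 * (1 + C) + 2 * cp ^ 2 * M) * √j := by
      rw [hLdef, hK]; field_simp
    rw [e]
    refine mul_le_mul_of_nonneg_right ?_ (by positivity)
    have : cp ^ 2 + 2 * cp ^ 2 * M ≤ (cp ^ 2 + 2 * cp ^ 2 * M) * √j :=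
      le_mul_of_one_le_right (by positivity) hj1
    linarith
  have hfin : L * (cm / 2) * τ - (L * cp * j + cp ^ 2 * B₁ + 2 * cp * (L * B₂ + L * B)) ≤
      L ^ 2 * ∑ t ∈ Finset.range τ, ∫ ω, moves cp (X₀ ω) (d ω) t j ∂P := by
    linarith
  have hL2 : 0 < L ^ 2 := by positivity
  rw [← div_le_iff₀' hL2] at hfin
  refine le_trans (le_of_eq ?_) hfin
  rw [sub_div]
  congr 1
  rw [hLdef]
  have : √(j : ℝ) ≠ 0 := by positivity
  field_simp

end Rates

/-! ### Asymptotic rates -/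

section Averages

variable {u : ℕ → ℝ} {c B : ℝ}

theorem average_mem_Icc (hu : ∀ t, u t ∈ Set.Icc (0 : ℝ) 1) (τ : ℕ) :
    (τ : ℝ)⁻¹ * ∑ t ∈ Finset.range τ, u t ∈ Set.Icc (0 : ℝ) 1 := by
  have h0 : 0 ≤ ∑ t ∈ Finset.range τ, u t := Finset.sum_nonneg fun t _ => (hu t).1
  have h1 : ∑ t ∈ Finset.range τ, u t ≤ τ := by
    refine (Finset.sum_le_sum fun t _ => (hu t).2).trans ?_
    simp
  exact ⟨by positivity, inv_mul_le_one_of_le₀ h1 (Nat.cast_nonneg τ)⟩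

theorem isBoundedUnder_le_average (hu : ∀ t, u t ∈ Set.Icc (0 : ℝ) 1) :
    IsBoundedUnder (· ≤ ·) atTop fun τ : ℕ => (τ : ℝ)⁻¹ * ∑ t ∈ Finset.range τ, u t :=
  isBoundedUnder_of ⟨1, fun τ => (average_mem_Icc hu τ).2⟩

theorem isBoundedUnder_ge_average (hu : ∀ t, u t ∈ Set.Icc (0 : ℝ) 1) :
    IsBoundedUnder (· ≥ ·) atTop fun τ : ℕ => (τ : ℝ)⁻¹ * ∑ t ∈ Finset.range τ, u t :=
  isBoundedUnder_of ⟨0, fun τ => (average_mem_Icc hu τ).1⟩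

theorem tendsto_add_inv_mul (c B : ℝ) :
    Tendsto (fun τ : ℕ => c + (τ : ℝ)⁻¹ * B) atTop (nhds c) := by
  simpa using (tendsto_inv_atTop_nhds_zero_nat (𝕜 := ℝ)).mul_const B |>.const_add c

theorem limsup_average_le (hu : ∀ t, u t ∈ Set.Icc (0 : ℝ) 1)
    (h : ∀ τ : ℕ, ∑ t ∈ Finset.range τ, u t ≤ c * τ + B) :
    limsup (fun τ : ℕ => (τ : ℝ)⁻¹ * ∑ t ∈ Finset.range τ, u t) atTop ≤ c := by
  have ht := tendsto_add_inv_mul c B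
  rw [← ht.limsup_eq]
  refine limsup_le_limsup ?_ (isBoundedUnder_ge_average hu).isCoboundedUnder_le
    ht.isBoundedUnder_le
  filter_upwards [eventually_gt_atTop 0] with τ hτ
  have hτ0 : (0 : ℝ) < τ := by exact_mod_cast hτ
  refine (mul_le_mul_of_nonneg_left (h τ) (inv_nonneg.mpr hτ0.le)).trans (le_of_eq ?_)
  field_simp

theorem le_liminf_average (hu : ∀ t, u t ∈ Set.Icc (0 : ℝ) 1)
    (h : ∀ τ : ℕ, c * τ - B ≤ ∑ t ∈ Finset.range τ, u t) :
    c ≤ liminf (fun τ : ℕ => (τ : ℝ)⁻¹ * ∑ t ∈ Finset.range τ, u t) atTop := by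
  have ht := tendsto_add_inv_mul c (-B)
  rw [← ht.liminf_eq]
  refine liminf_le_liminf ?_ ht.isBoundedUnder_ge
    (isBoundedUnder_le_average hu).isCoboundedUnder_ge
  filter_upwards [eventually_gt_atTop 0] with τ hτ
  have hτ0 : (0 : ℝ) < τ := by exact_mod_cast hτ
  refine le_trans (le_of_eq ?_) (mul_le_mul_of_nonneg_left (h τ) (inv_nonneg.mpr hτ0.le))
  field_simp
  ring

end Averages

section Clamp

variable {Ω : Type*} [MeasurableSpace Ω] {P : Measure Ω} {μ : Measure ℝ} {cm cp : ℝ}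
  {X₀ : Ω → ℕ → ℝ} {ξ : ℕ → ℕ → Ω → ℝ}

theorem measurable_clamp (cm cp : ℝ) : Measurable fun y : ℝ => max cm (min cp y) :=
  measurable_const.max (measurable_const.min measurable_id)

/-- Stopping distances with values in `[cm, cp]` almost surely agree with their truncations. -/
theorem ae_eq_clamp (hsupp : ∀ᵐ x ∂μ, x ∈ Set.Icc cm cp) (hm : ∀ t i, Measurable (ξ t i))
    (hmap : ∀ t i, P.map (ξ t i) = μ) :
    ∀ᵐ ω ∂P, ∀ t i, max cm (min cp (ξ t i ω)) = ξ t i ω := by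
  rw [ae_all_iff]
  intro t
  rw [ae_all_iff]
  intro i
  rw [← hmap t i] at hsupp
  filter_upwards [ae_of_ae_map (hm t i).aemeasurable hsupp] with ω hω
  rw [min_eq_right hω.2, max_eq_right hω.1]

theorem isQueueInput_clamp (hc : cm ≤ cp)
    (hsupp : ∀ᵐ x ∂μ, x ∈ Set.Icc cm cp) (hmean : ∫ x, x ∂μ = 1) (hX : Measurable X₀)
    (hX₀ : ∀ ω, X₀ ω ∈ queueConfigs cm cp) (hm : ∀ t i, Measurable (ξ t i))
    (hmap : ∀ t i, P.map (ξ t i) = μ) (hind : iIndepFun (fun p : ℕ × ℕ => ξ p.1 p.2) P)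
    (hind₀ : IndepFun X₀ (fun ω (p : ℕ × ℕ) => ξ p.1 p.2 ω) P) :
    IsQueueInput P cm cp (variance (fun x : ℝ => x) μ) X₀
      fun ω t i => max cm (min cp (ξ t i ω)) := by
  have hae := ae_eq_clamp hsupp hm hmap
  have hφ := measurable_clamp cm cp
  refine ⟨hX, hX₀, fun t i => hφ.comp (hm t i),
    fun ω t i => ⟨le_max_left _ _, max_le hc (min_le_left _ _)⟩, fun t i => ?_, fun t i => ?_,
    hind.comp (fun _ y => max cm (min cp y)) fun _ => hφ, ?_⟩
  · rw [← hmean, ← hmap t i, integral_map (hm t i).aemeasurable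
      measurable_id'.aestronglyMeasurable]
    exact integral_congr_ae (hae.mono fun ω hω => hω t i)
  · rw [variance_eq_integral measurable_id'.aemeasurable, hmean, ← hmap t i,
      integral_map (hm t i).aemeasurable
        ((measurable_id'.sub_const 1).pow_const 2).aestronglyMeasurable]
    exact integral_congr_ae (hae.mono fun ω hω => by simp only [hω t i])
  · exact hind₀.comp measurable_id (measurable_pi_lambda
      (fun (e : ℕ × ℕ → ℝ) p => max cm (min cp (e p))) fun p => hφ.comp (measurable_pi_apply p))

end Clamp

theorem rpow_neg_half_eq (j : ℕ) : (j : ℝ) ^ (-(1 / 2) : ℝ) = 1 / √j := by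
  rw [Real.rpow_neg (Nat.cast_nonneg j), ← Real.sqrt_eq_rpow, one_div]

theorem proposition1 (μ : Measure ℝ) [IsProbabilityMeasure μ] (cm cp : ℝ) (hcm : 0 < cm)
    (hsupp : ∀ᵐ x ∂μ, x ∈ Set.Icc cm cp)
    (hmean : ∫ x, x ∂μ = 1) (hvar : 0 < variance (fun x : ℝ => x) μ) :
    ∃ am ap : ℝ, 0 < am ∧ am < ap ∧
      ∀ (Ω : Type*) [MeasurableSpace Ω] (P : Measure Ω) [IsProbabilityMeasure P]
        (X₀ : Ω → ℕ → ℝ) (ξ : ℕ → ℕ → Ω → ℝ),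
        Measurable X₀ →
        (∀ ω, X₀ ω ∈ queueConfigs cm cp) →
        (∀ t i, Measurable (ξ t i)) →
        (∀ t i, P.map (ξ t i) = μ) →
        iIndepFun (fun p : ℕ × ℕ => ξ p.1 p.2) P →
        IndepFun X₀ (fun ω (p : ℕ × ℕ) => ξ p.1 p.2 ω) P →
        ∀ j : ℕ, 1 ≤ j →
          am * (j : ℝ) ^ (-(1 / 2) : ℝ) ≤ lowerWaveRate P cp X₀ ξ j ∧
          lowerWaveRate P cp X₀ ξ j ≤ upperWaveRate P cp X₀ ξ j ∧
          upperWaveRate P cp X₀ ξ j ≤ ap * (j : ℝ) ^ (-(1 / 2) : ℝ) := by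
  obtain ⟨y, hy⟩ := hsupp.exists
  have hc : cm ≤ cp := hy.1.trans hy.2
  have hcp : 0 < cp := hcm.trans_le hc
  obtain ⟨K, hK, hlower⟩ := exists_le_sum_integral_moves hcm hcp hvar
  set C : ℝ := 20 * cp ^ 2 / variance (fun x : ℝ => x) μ + 1
  have hC : 0 < C := by positivity
  refine ⟨cm / (2 * K), cm / (2 * K) + C, by positivity, by linarith,
    fun Ω _ P _ X₀ ξ hX hX₀ hm hmap hind hind₀ j hj => ?_⟩
  have h := isQueueInput_clamp hc hsupp hmean hX hX₀ hm hmap hind hind₀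
  have havg : ∀ τ, avgWaveProb P cp X₀ ξ j τ = (τ : ℝ)⁻¹ * ∑ t ∈ Finset.range τ,
      ∫ ω, moves cp (X₀ ω) (fun t i => max cm (min cp (ξ t i ω))) t j ∂P := by
    intro τ
    rw [avgWaveProb]
    congr 1
    refine Finset.sum_congr rfl fun t _ => ?_
    rw [h.integral_moves]
    refine measureReal_congr ?_
    filter_upwards [ae_eq_clamp hsupp hm hmap] with ω hω
    have : (fun t i => max cm (min cp (ξ t i ω))) = fun t i => ξ t i ω := by
      funext t i; exact hω t i
    change ((j : ℕ∞) < queueWave cp (X₀ ω) (fun s i => ξ s i ω) t) =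
      ((j : ℕ∞) < queueWave cp (X₀ ω) (fun t i => max cm (min cp (ξ t i ω))) t)
    rw [this]
  have hu : ∀ t, ∫ ω, moves cp (X₀ ω) (fun t i => max cm (min cp (ξ t i ω))) t j ∂P ∈
      Set.Icc (0 : ℝ) 1 := fun t => by
    rw [h.integral_moves]
    exact ⟨measureReal_nonneg, measureReal_le_one⟩
  obtain ⟨B, hB⟩ := h.sum_integral_moves_le hcm hvar hj
  obtain ⟨B', hB'⟩ := hlower Ω P X₀ _ h j hj
  simp only [lowerWaveRate, upperWaveRate, havg, rpow_neg_half_eq, mul_one_div]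
  refine ⟨le_liminf_average hu hB', liminf_le_limsup (isBoundedUnder_le_average hu)
    (isBoundedUnder_ge_average hu), (limsup_average_le hu hB).trans ?_⟩
  have : 0 < cm / (2 * K) := by positivity
  exact div_le_div_of_nonneg_right (by linarith) (Real.sqrt_nonneg _)
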